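/- Let $K$ be an algebraically closed field of arbitrary characteristic and $1\le d<n$. Let $G=SL_n(K)$, let $T$, $B$ be the diagonal and the upper triangular matrices in $G$, and let $P=P_d\supset B$ be the stabilizer of $\langle e_1,\dots,e_d\rangle$, so that $G/P$ is the Grassmannian $G_{d,n}$ of $d$-dimensional subspaces of $K^n$, a projective variety by the Plücker embedding. Let $R=\{\epsilon_i-\epsilon_j: i\ne j\}$ be the roots, $R^+=\{\epsilon_i-\epsilon_j: i<j\}$, let $R_P^+$ be the set of $\epsilon_i-\epsilon_j$ with $i<j\le d$ or $d<i<j$, and let $X_{\epsilon_i-\epsilon_j}=E_{ij}\in\mathfrak{sl}_n(K)$ be the root vectors. Let $W=S_n$, $W_P=S_d\times S_{n-d}$, and let $W^P\subset W$ be the set of the $\sigma$ with $\sigma(1)<\dots<\sigma(d)$ and $\sigma(d+1)<\dots<\sigma(n)$. Identify the coset $\sigma W_P$ with the increasing rearrangement $(\sigma_1<\dots<\sigma_d)$ of $\sigma(1),\dots,\sigma(d)$, and write $\sigma\ge\rho\ (\mathrm{mod}\ W_P)$ if $\sigma_t\ge\rho_t$ for $1\le t\le d$; on $W^P$ this is the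 order $\sigma\ge\rho$. For $\tau\in W^P$ let $e_\tau=\langle e_{\tau(1)},\dots,e_{\tau(d)}\rangle\in G_{d,n}$. For $w,v\in W^P$ let $X_w^v=X_w\cap X^v$ be the Richardson variety (with its reduced structure), where $$X_w=\{U\in G_{d,n} : \dim (U\cap\langle e_1,\dots,e_{w(t)}\rangle)\ge t,\ 1\le t\le d\},$$ $$X^v=\{U\in G_{d,n} : \dim (U\cap\langle e_n,e_{n-1},\dots,e_{v(d-t+1)}\rangle)\ge t,\ 1\le t\le d\}.$$ Let $w,\tau,v\in W^P$ with $w\ge\tau\ge v$; then $e_\tau\in X_w^v$. Let $T_{w,\tau}^v=\mathrm{Der}_K(\mathcal O_{X_w^v,e_\tau},K)$ be the Zariski tangent space to $X_w^v$ at $e_\tau$, regarded as a subspace of the tangent space $T_{e_\tau}(G/P)$, and regard an element of $\mathfrak{sl}_n(K)$ as an element of $T_{e_\tau}(G/P)$ by the differential at $1$ of the orbit map $g\mapsto g\,e_\tau$. Then $$\{X_{-\beta} : \beta\in\tau(R^+\setminus R_P^+),\ w\ge s_\beta\tau\ge v\ (\mathrm{mod}\ W_P)\}$$ is a basis of $T_{w,\tau}^v$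 (the $X_{-\beta}$ for distinct such $\beta$ being distinct); in particular $$\dim T_{w,\tau}^v=\#\{\beta\in\tau(R^+\setminus R_P^+) : w\ge s_\beta\tau\ge v\ (\mathrm{mod}\ W_P)\}.$$ -/

import Mathlib

open Filter Topology LinearAlgebra.Projectivization

namespace Richardson

noncomputable section

/-! ### Varieties in projective space: Zariski topology, local rings, Zariski tangent spaces -/

/-- The basic open set `D(h) = {x | h(x) ≠ 0}` of the projective space `ℙ(K^ι)`; it is used for
homogeneous `h` only, for which the choice of homogeneous coordinates does not matter. -/
def basicOpen {K ι : Type*} [Field K] (h : MvPolynomial ι K) : Set (ℙ K (ι → K)) :=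
  {x | MvPolynomial.eval x.rep h ≠ 0}

/-- The Zariski topology of `ℙ(K^ι)`, generated by the sets `D(h)` with `h` homogeneous. -/
instance zariskiTopology {K ι : Type*} [Field K] : TopologicalSpace (ℙ K (ι → K)) :=
  TopologicalSpace.generateFrom
    {U | ∃ (m : ℕ) (h : MvPolynomial ι K), h.IsHomogeneous m ∧ U = basicOpen h}

/-- The function `P / Q` on `ℙ(K^ι)`; it is used for `P`, `Q` homogeneous of the same degree. -/
def ratio {K ι : Type*} [Field K] (P Q : MvPolynomial ι K) (y : ℙ K (ι → K)) : K :=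
  MvPolynomial.eval y.rep P / MvPolynomial.eval y.rep Q

/-- Germs of `K`-valued functions form a `K`-algebra, with the pointwise operations. -/
instance germAlgebra {K α : Type*} [Field K] {l : Filter α} : Algebra K (Germ l K) :=
  Algebra.ofModule
    (fun r x y => by
      induction x using Germ.inductionOn
      induction y using Germ.inductionOn
      simp only [← Germ.coe_mul, ← Germ.coe_smul, smul_mul_assoc])
    (fun r x y => by
      induction x using Germ.inductionOn
      induction y using Germ.inductionOn
      simp only [← Germ.coe_mul, ← Germ.coe_smul, mul_smul_comm])

theorem algebraMap_germ {K α : Type*} [Field K] {l : Filter α} (r : K) :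
    algebraMap K (Germ l K) r = ((fun _ => r : α → K) : Germ l K) := by
  rw [Algebra.algebraMap_eq_smul_one, ← Germ.coe_one, ← Germ.coe_smul]
  congr 1
  funext a
  simp

theorem isOpen_basicOpen {K ι : Type*} [Field K] {m : ℕ} {h : MvPolynomial ι K}
    (hh : h.IsHomogeneous m) : IsOpen (basicOpen h) :=
  TopologicalSpace.isOpen_generateFrom_of_mem ⟨m, h, hh, rfl⟩

theorem eventually_ne {K ι : Type*} [Field K] {X : Set (ℙ K (ι → K))} {x : X} {m : ℕ}
    {h : MvPolynomial ι K} (hh : h.IsHomogeneous m)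
    (hx : MvPolynomial.eval x.1.rep h ≠ 0) :
    ∀ᶠ y : X in 𝓝 x, MvPolynomial.eval y.1.rep h ≠ 0 :=
  continuous_subtype_val.continuousAt.eventually ((isOpen_basicOpen hh).mem_nhds hx)

/-- The local ring `𝒪_{X,x}` of a (locally closed, reduced) subvariety `X` of `ℙ(K^ι)` at a point
`x ∈ X`: the `K`-algebra of germs at `x`, for the Zariski topology of `X`, of regular functions,
that is, of functions which near `x` are a quotient of two homogeneous polynomials of the same
degree, the denominator not vanishing at `x`. -/
def localRing {K ι : Type*} [Field K] (X : Set (ℙ K (ι → K))) (x : X) :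
    Subalgebra K (Germ (𝓝 x) K) where
  carrier := {φ | ∃ (m : ℕ) (P Q : MvPolynomial ι K), P.IsHomogeneous m ∧ Q.IsHomogeneous m ∧
    MvPolynomial.eval x.1.rep Q ≠ 0 ∧ φ = ((fun y : X => ratio P Q y.1) : Germ (𝓝 x) K)}
  mul_mem' := by
    rintro _ _ ⟨m, P, Q, hP, hQ, h0, rfl⟩ ⟨m', P', Q', hP', hQ', h0', rfl⟩
    refine ⟨m + m', P * P', Q * Q', hP.mul hP', hQ.mul hQ', ?_, ?_⟩
    · simpa using ⟨h0, h0'⟩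
    · rw [← Germ.coe_mul]
      congr 1
      funext y
      simp [ratio, div_mul_div_comm]
  add_mem' := by
    rintro _ _ ⟨m, P, Q, hP, hQ, h0, rfl⟩ ⟨m', P', Q', hP', hQ', h0', rfl⟩
    refine ⟨m + m', P * Q' + Q * P', Q * Q', (hP.mul hQ').add (hQ.mul hP'), hQ.mul hQ', ?_, ?_⟩
    · simpa using ⟨h0, h0'⟩
    · rw [← Germ.coe_add, Germ.coe_eq]
      filter_upwards [eventually_ne hQ h0, eventually_ne hQ' h0'] with y hy hy'
      simp [ratio, div_add_div _ _ hy hy']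
  algebraMap_mem' := by
    intro r
    refine ⟨0, MvPolynomial.C r, 1, MvPolynomial.isHomogeneous_C _ _,
      MvPolynomial.isHomogeneous_one _ _, by simp, ?_⟩
    rw [algebraMap_germ]
    congr 1
    funext y
    simp [ratio]

/-- The value `f(x)` of a germ of a regular function `f ∈ 𝒪_{X,x}`. -/
def value {K ι : Type*} [Field K] {X : Set (ℙ K (ι → K))} {x : X} (f : localRing X x) : K :=
  f.1.value

/-- The Zariski tangent space `T_x(X) = Der_K(𝒪_{X,x}, K)`. -/
def tangentSpace {K ι : Type*} [Field K] (X : Set (ℙ K (ι → K))) (x : X) :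
    Submodule K (localRing X x →ₗ[K] K) where
  carrier := {D | ∀ a b, D (a * b) = D a * value b + value a * D b}
  add_mem' := by
    intro D E hD hE a b
    simp only [LinearMap.add_apply, hD a b, hE a b]
    ring
  zero_mem' := by
    intro a b
    simp
  smul_mem' := by
    intro c D hD a b
    simp only [LinearMap.smul_apply, hD a b, smul_eq_mul]
    ring

/-- Restriction of functions `𝒪_{Y,x} → 𝒪_{X,x}` for `x ∈ X ⊆ Y`. -/
def restrict {K ι : Type*} [Field K] {X Y : Set (ℙ K (ι → K))} (h : X ⊆ Y) (x : X) :
    localRing Y ⟨x.1, h x.2⟩ →ₗ[K] localRing X x where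
  toFun f := ⟨f.1.compTendsto (Set.inclusion h) (continuous_inclusion h).continuousAt, by
    obtain ⟨m, P, Q, hP, hQ, h0, hf⟩ := f.2
    exact ⟨m, P, Q, hP, hQ, h0, by rw [hf]; rfl⟩⟩
  map_add' := by
    rintro ⟨f, hf⟩ ⟨g, hg⟩
    induction f using Germ.inductionOn
    induction g using Germ.inductionOn
    rfl
  map_smul' := by
    rintro r ⟨f, hf⟩
    induction f using Germ.inductionOn
    rfl

theorem restrict_mul {K ι : Type*} [Field K] {X Y : Set (ℙ K (ι → K))} (h : X ⊆ Y) (x : X)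
    (f g : localRing Y ⟨x.1, h x.2⟩) : restrict h x (f * g) = restrict h x f * restrict h x g := by
  obtain ⟨f, hf⟩ := f
  obtain ⟨g, hg⟩ := g
  induction f using Germ.inductionOn
  induction g using Germ.inductionOn
  rfl

theorem value_restrict {K ι : Type*} [Field K] {X Y : Set (ℙ K (ι → K))} (h : X ⊆ Y) (x : X)
    (f : localRing Y ⟨x.1, h x.2⟩) : value (restrict h x f) = value f := by
  obtain ⟨f, hf⟩ := f
  induction f using Germ.inductionOn
  rfl

/-- For `x ∈ X ⊆ Y`, the differential `T_x(X) → T_x(Y)` of the inclusion of `X` in `Y`. -/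
def tangentInclusion {K ι : Type*} [Field K] {X Y : Set (ℙ K (ι → K))} (h : X ⊆ Y) (x : X) :
    tangentSpace X x →ₗ[K] tangentSpace Y ⟨x.1, h x.2⟩ where
  toFun D := ⟨D.1 ∘ₗ restrict h x, fun a b => by
    simp only [LinearMap.comp_apply, restrict_mul, D.2 _ _, value_restrict]⟩
  map_add' _ _ := rfl
  map_smul' _ _ := rfl

/-- `T_x(X)` is a subspace of `T_x(Y)`. -/
theorem tangentInclusion_injective {K ι : Type*} [Field K] {X Y : Set (ℙ K (ι → K))} (h : X ⊆ Y)
    (x : X) : Function.Injective (tangentInclusion h x) := by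
  intro D E hDE
  apply Subtype.ext
  apply LinearMap.ext
  rintro ⟨f, m, P, Q, hP, hQ, h0, rfl⟩
  have := LinearMap.congr_fun (congrArg Subtype.val hDE)
    ⟨((fun y : Y => ratio P Q y.1) : Germ (𝓝 (⟨x.1, h x.2⟩ : Y)) K), m, P, Q, hP, hQ, h0, rfl⟩
  exact this

/-! ### Velocity vectors of rational curves -/

/-- The derivative at `t = 0` of the rational function `P(c(t)) / Q(c(t))` of `t`. -/
def curveDeriv {K ι : Type*} [Field K] (c : ι → Polynomial K) (P Q : MvPolynomial ι K) : K :=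
  (Polynomial.derivative (MvPolynomial.aeval c P) * MvPolynomial.aeval c Q
    - MvPolynomial.aeval c P * Polynomial.derivative (MvPolynomial.aeval c Q)).eval 0
    / ((MvPolynomial.aeval c Q).eval 0) ^ 2

/-- The curve `t ↦ [c(t)]`, with polynomial coordinates, runs in `X` for all but finitely many `t`
and passes through `x` at `t = 0`. -/
structure IsCurveIn {K ι : Type*} [Field K] (X : Set (ℙ K (ι → K))) (x : X)
    (c : ι → Polynomial K) : Prop where
  mem : ∃ b : Polynomial K, b ≠ 0 ∧ ∀ t : K, b.eval t ≠ 0 →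
    ∃ h : (fun i => (c i).eval t) ≠ 0, Projectivization.mk K (fun i => (c i).eval t) h ∈ X
  zero : ∃ h : (fun i => (c i).eval 0) ≠ 0,
    Projectivization.mk K (fun i => (c i).eval 0) h = x.1

theorem eval_smul_of_isHomogeneous {K ι : Type*} [Field K] {m : ℕ} {P : MvPolynomial ι K}
    (hP : P.IsHomogeneous m) (a : K) (u : ι → K) :
    MvPolynomial.eval (a • u) P = a ^ m * MvPolynomial.eval u P := by
  rw [MvPolynomial.eval_eq, MvPolynomial.eval_eq, Finset.mul_sum]
  refine Finset.sum_congr rfl fun s hs => ?_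
  have hd : ∑ i ∈ s.support, s i = m := by
    have := hP (MvPolynomial.mem_support_iff.mp hs)
    simpa [Finsupp.weight_apply, Finsupp.sum] using this
  simp only [Pi.smul_apply, smul_eq_mul, mul_pow, Finset.prod_mul_distrib,
    Finset.prod_pow_eq_pow_sum, hd]
  ring

theorem eval_aeval {K ι : Type*} [Field K] (c : ι → Polynomial K) (P : MvPolynomial ι K) (t : K) :
    (MvPolynomial.aeval c P).eval t = MvPolynomial.eval (fun i => (c i).eval t) P := by
  induction P using MvPolynomial.induction_on with
  | C a => simp
  | add p q hp hq => simp [hp, hq]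
  | mul_X p i hp => simp [hp]

theorem exists_basicOpen {K ι : Type*} [Field K] {X : Set (ℙ K (ι → K))} {x : X} {p : X → Prop}
    (hp : ∀ᶠ y in 𝓝 x, p y) : ∃ (m : ℕ) (h : MvPolynomial ι K), h.IsHomogeneous m ∧
      MvPolynomial.eval x.1.rep h ≠ 0 ∧ ∀ y : X, MvPolynomial.eval y.1.rep h ≠ 0 → p y := by
  rw [nhds_subtype_eq_comap] at hp
  obtain ⟨V, hV, hVp⟩ := Filter.mem_comap.mp hp
  have hb := TopologicalSpace.isTopologicalBasis_of_subbasis_of_inter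
    (t := (zariskiTopology : TopologicalSpace (ℙ K (ι → K)))) rfl (by
      rintro _ ⟨m, h, hh, rfl⟩ _ ⟨m', h', hh', rfl⟩
      refine ⟨m + m', h * h', hh.mul hh', ?_⟩
      ext y
      simp [basicOpen])
  obtain ⟨U, hU, hxU, hUV⟩ := hb.mem_nhds_iff.mp hV
  rcases hU with rfl | ⟨m, h, hh, rfl⟩
  · exact ⟨0, 1, MvPolynomial.isHomogeneous_one _ _, by simp,
      fun y _ => hVp (hUV (Set.mem_univ _))⟩
  · exact ⟨m, h, hh, hxU, fun y hy => hVp (hUV hy)⟩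

theorem IsCurveIn.eval_zero_ne {K ι : Type*} [Field K] {X : Set (ℙ K (ι → K))} {x : X}
    {c : ι → Polynomial K} (hc : IsCurveIn X x c) {m : ℕ} {Q : MvPolynomial ι K}
    (hQ : Q.IsHomogeneous m) (h0 : MvPolynomial.eval x.1.rep Q ≠ 0) :
    (MvPolynomial.aeval c Q).eval 0 ≠ 0 := by
  obtain ⟨h, hx⟩ := hc.zero
  obtain ⟨a, ha⟩ := Projectivization.exists_smul_eq_mk_rep K _ h
  rw [hx] at ha
  rw [← ha, Units.smul_def, eval_smul_of_isHomogeneous hQ] at h0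
  rw [eval_aeval]
  exact right_ne_zero_of_mul h0

theorem curveDeriv_congr {K ι : Type*} [Field K] [Infinite K] {X : Set (ℙ K (ι → K))} {x : X}
    {c : ι → Polynomial K} (hc : IsCurveIn X x c) {m m' : ℕ} {P Q P' Q' : MvPolynomial ι K}
    (hP : P.IsHomogeneous m) (hQ : Q.IsHomogeneous m) (h0 : MvPolynomial.eval x.1.rep Q ≠ 0)
    (hP' : P'.IsHomogeneous m') (hQ' : Q'.IsHomogeneous m')
    (h0' : MvPolynomial.eval x.1.rep Q' ≠ 0)
    (he : ((fun y : X => ratio P Q y.1) : Germ (𝓝 x) K) = (fun y : X => ratio P' Q' y.1)) :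
    curveDeriv c P Q = curveDeriv c P' Q' := by
  have hq := hc.eval_zero_ne hQ h0
  have hq' := hc.eval_zero_ne hQ' h0'
  obtain ⟨k, h, hh, hx, hy⟩ := exists_basicOpen
    ((Germ.coe_eq.mp he).and ((eventually_ne hQ h0).and (eventually_ne hQ' h0')))
  have hg := hc.eval_zero_ne hh hx
  obtain ⟨b, hb, hbX⟩ := hc.mem
  set p := MvPolynomial.aeval c P
  set q := MvPolynomial.aeval c Q
  set p' := MvPolynomial.aeval c P'
  set q' := MvPolynomial.aeval c Q'
  set g := MvPolynomial.aeval c h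
  have hprod : (p * q' - p' * q) * (g * b) = 0 := by
    apply Polynomial.funext
    intro t
    by_cases hbt : b.eval t = 0
    · simp [hbt]
    by_cases hgt : g.eval t = 0
    · simp [hgt]
    obtain ⟨hne, hX⟩ := hbX t hbt
    obtain ⟨a, ha⟩ := Projectivization.exists_smul_eq_mk_rep K _ hne
    have ha0 : (a : K) ≠ 0 := a.ne_zero
    have key : ∀ {k : ℕ} {S : MvPolynomial ι K}, S.IsHomogeneous k →
        MvPolynomial.eval (Projectivization.mk K _ hne).rep S
          = (a : K) ^ k * (MvPolynomial.aeval c S).eval t := by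
      intro k S hS
      rw [← ha, Units.smul_def, eval_smul_of_isHomogeneous hS, eval_aeval]
    obtain ⟨h1, h2, h3⟩ := hy ⟨_, hX⟩ (by
      simp only [key hh]
      exact mul_ne_zero (pow_ne_zero _ ha0) hgt)
    simp only [key hQ] at h2
    simp only [key hQ'] at h3
    simp only [ratio, key hP, key hQ, key hP', key hQ'] at h1
    rw [mul_div_mul_left _ _ (pow_ne_zero _ ha0), mul_div_mul_left _ _ (pow_ne_zero _ ha0),
      div_eq_div_iff (right_ne_zero_of_mul h2) (right_ne_zero_of_mul h3)] at h1
    simp only [Polynomial.eval_mul, Polynomial.eval_sub, Polynomial.eval_zero]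
    rw [sub_eq_zero.mpr h1, zero_mul]
  have hg0 : g * b ≠ 0 := mul_ne_zero (fun h => hg (by simp [h])) hb
  have heq : p * q' = p' * q := sub_eq_zero.mp ((mul_eq_zero.mp hprod).resolve_right hg0)
  have e0 := congrArg (Polynomial.eval 0) heq
  have e1 := congrArg (Polynomial.eval 0) (congrArg Polynomial.derivative heq)
  simp only [Polynomial.derivative_mul, Polynomial.eval_mul, Polynomial.eval_add] at e0 e1
  simp only [curveDeriv]
  rw [div_eq_div_iff (pow_ne_zero _ hq) (pow_ne_zero _ hq')]
  simp only [Polynomial.eval_mul, Polynomial.eval_sub]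
  linear_combination (q.eval 0 * q'.eval 0) * e1
    - (q.derivative.eval 0 * q'.eval 0 + q'.derivative.eval 0 * q.eval 0) * e0

/-- The velocity vector in `T_x(X)` at `t = 0` of a curve `t ↦ [c(t)]` in `X` through `x`: the
derivation `f ↦ d/dt f([c(t)])` at `t = 0` of `𝒪_{X,x}`. -/
def velocity {K ι : Type*} [Field K] [Infinite K] {X : Set (ℙ K (ι → K))} {x : X}
    {c : ι → Polynomial K} (hc : IsCurveIn X x c) : tangentSpace X x :=
  let D : localRing X x → K := fun f => curveDeriv c f.2.choose_spec.choose
    f.2.choose_spec.choose_spec.choose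
  have hD : ∀ (f : localRing X x) (m : ℕ) (P Q : MvPolynomial ι K), P.IsHomogeneous m →
      Q.IsHomogeneous m → MvPolynomial.eval x.1.rep Q ≠ 0 →
      f.1 = ((fun y : X => ratio P Q y.1) : Germ (𝓝 x) K) → D f = curveDeriv c P Q := by
    intro f m P Q hP hQ h0 hf
    obtain ⟨hP', hQ', h0', hf'⟩ := f.2.choose_spec.choose_spec.choose_spec
    exact curveDeriv_congr hc hP' hQ' h0' hP hQ h0 (hf'.symm.trans hf)
  ⟨{ toFun := D
     map_add' := by
      intro f g
      obtain ⟨m, P, Q, hP, hQ, h0, hf⟩ := f.2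
      obtain ⟨m', P', Q', hP', hQ', h0', hg⟩ := g.2
      have hq := hc.eval_zero_ne hQ h0
      have hq' := hc.eval_zero_ne hQ' h0'
      rw [hD f m P Q hP hQ h0 hf, hD g m' P' Q' hP' hQ' h0' hg,
        hD (f + g) (m + m') (P * Q' + Q * P') (Q * Q') ((hP.mul hQ').add (hQ.mul hP'))
          (hQ.mul hQ') (by simpa using ⟨h0, h0'⟩) (by
            change f.1 + g.1 = _
            rw [hf, hg, ← Germ.coe_add, Germ.coe_eq]
            filter_upwards [eventually_ne hQ h0, eventually_ne hQ' h0'] with y hy hy'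
            simp [ratio, div_add_div _ _ hy hy'])]
      simp only [curveDeriv, map_add, map_mul, Polynomial.derivative_mul, Polynomial.eval_mul,
        Polynomial.eval_sub, Polynomial.eval_add]
      field_simp
      ring
     map_smul' := by
      intro r f
      obtain ⟨m, P, Q, hP, hQ, h0, hf⟩ := f.2
      rw [hD f m P Q hP hQ h0 hf, hD (r • f) m (r • P) Q
          (by
            rw [MvPolynomial.smul_eq_C_mul]
            simpa using (MvPolynomial.isHomogeneous_C _ r).mul hP) hQ h0 (by
            change r • f.1 = _
            rw [hf, ← Germ.coe_smul]
            congr 1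
            funext y
            simp [ratio, mul_div_assoc])]
      simp only [curveDeriv, map_smul, Polynomial.eval_mul,
        Polynomial.eval_sub, Polynomial.eval_smul, RingHom.id_apply, smul_eq_mul]
      ring },
    by
      intro f g
      change D (f * g) = D f * value g + value f * D g
      obtain ⟨m, P, Q, hP, hQ, h0, hf⟩ := f.2
      obtain ⟨m', P', Q', hP', hQ', h0', hg⟩ := g.2
      have hq := hc.eval_zero_ne hQ h0
      have hq' := hc.eval_zero_ne hQ' h0'
      have hval : ∀ (f : localRing X x) (m : ℕ) (P Q : MvPolynomial ι K), P.IsHomogeneous m →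
          Q.IsHomogeneous m → f.1 = ((fun y : X => ratio P Q y.1) : Germ (𝓝 x) K) →
          value f = (MvPolynomial.aeval c P).eval 0 / (MvPolynomial.aeval c Q).eval 0 := by
        intro f m P Q hP hQ hf
        obtain ⟨h, hx⟩ := hc.zero
        obtain ⟨a, ha⟩ := Projectivization.exists_smul_eq_mk_rep K _ h
        rw [hx] at ha
        have ha0 : (a : K) ≠ 0 := a.ne_zero
        rw [value, hf, Germ.value_ofFun, ratio, ← ha, Units.smul_def,
          eval_smul_of_isHomogeneous hP, eval_smul_of_isHomogeneous hQ,
          mul_div_mul_left _ _ (pow_ne_zero _ ha0), eval_aeval, eval_aeval]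
      rw [hD f m P Q hP hQ h0 hf, hD g m' P' Q' hP' hQ' h0' hg, hval f m P Q hP hQ hf,
        hval g m' P' Q' hP' hQ' hg,
        hD (f * g) (m + m') (P * P') (Q * Q') (hP.mul hP') (hQ.mul hQ')
          (by simpa using ⟨h0, h0'⟩) (by
            change f.1 * g.1 = _
            rw [hf, hg, ← Germ.coe_mul]
            congr 1
            funext y
            simp [ratio, div_mul_div_comm])]
      simp only [curveDeriv, map_mul, Polynomial.derivative_mul, Polynomial.eval_mul,
        Polynomial.eval_sub, Polynomial.eval_add]
      field_simp
      ring⟩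

/-! ### The Grassmannian and its Plücker embedding -/

/-- The Grassmannian `G_{d,n}`, the set of `d`-dimensional subspaces of `K^n`. -/
def Grassmannian (K : Type*) [Field K] (d n : ℕ) : Type _ :=
  {U : Submodule K (Fin n → K) // Module.finrank K U = d}

/-- `I_{d,n}`: the strictly increasing `d`-tuples of indices in `{1, …, n}` (here `Fin n`), with
the partial order `i ≤ j ↔ ∀ t, i_t ≤ j_t`. -/
def Idx (d n : ℕ) : Type := Fin d ↪o Fin n

/-- The entry `i_t` of `i ∈ I_{d,n}`. -/
def Idx.entry {d n : ℕ} (i : Idx d n) (t : Fin d) : Fin n := (show Fin d ↪o Fin n from i) t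

instance idxPartialOrder {d n : ℕ} : PartialOrder (Idx d n) :=
  PartialOrder.lift Idx.entry fun _ _ h => DFunLike.coe_injective (F := Fin d ↪o Fin n) h

/-- The maximal minors of an `n × d` matrix `A`: for `i ∈ I_{d,n}`, the determinant of the
submatrix with rows `i_1, …, i_d`. -/
def minors {R : Type*} [CommRing R] {d n : ℕ} (A : Matrix (Fin n) (Fin d) R) (i : Idx d n) : R :=
  (A.submatrix i.entry id).det

theorem minors_ne_zero {K : Type*} [Field K] {d n : ℕ} {A : Matrix (Fin n) (Fin d) K}
    (hA : LinearIndependent K A.col) : minors A ≠ 0 := by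
  obtain ⟨κ, a, ha, hsp, hli⟩ := exists_linearIndependent' K A.row
  have : Fintype κ := Fintype.ofInjective a ha
  have hcard : Fintype.card κ = d := by
    rw [← finrank_span_eq_card hli, hsp, ← Matrix.rank_eq_finrank_span_row,
      ← Matrix.rank_transpose]
    simpa using LinearIndependent.rank_matrix (M := A.transpose) hA
  have hs : (Finset.univ.image a).card = d := by
    rw [Finset.card_image_of_injective _ ha, Finset.card_univ, hcard]
  let i := (Finset.univ.image a).orderEmbOfFin hs
  have hi : ∀ k, ∃ e, a e = i k := fun k => by
    obtain ⟨e, -, he⟩ := Finset.mem_image.mp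
      (Finset.orderEmbOfFin_mem (Finset.univ.image a) hs k)
    exact ⟨e, he⟩
  choose e he using hi
  have hinj : Function.Injective e := fun k l hkl => i.injective (by rw [← he, ← he, hkl])
  have hli' := hli.comp e hinj
  have hrow : LinearIndependent K (A.submatrix i id).row := by
    have : (A.submatrix i id).row = (A.row ∘ a) ∘ e := by
      funext k l
      change A (i k) l = A (a (e k)) l
      rw [he]
    rw [this]
    exact hli'
  have hu := Matrix.linearIndependent_rows_iff_isUnit.mp hrow
  intro h
  have h1 : (A.submatrix i id).det = 0 := congrFun h i
  rw [Matrix.isUnit_iff_isUnit_det, h1] at hu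
  exact not_isUnit_zero hu

/-- The point of `G_{d,n}` represented by an `n × d` matrix of rank `d`: the span of its columns. -/
def ofMatrix {K : Type*} [Field K] {d n : ℕ} (A : Matrix (Fin n) (Fin d) K)
    (hA : LinearIndependent K A.col) : Grassmannian K d n :=
  ⟨Submodule.span K (Set.range A.col), by rw [finrank_span_eq_card hA, Fintype.card_fin]⟩

/-- An `n × d` matrix which represents `U`: its columns are a basis of `U`. -/
def basisMatrix {K : Type*} [Field K] {d n : ℕ} (U : Grassmannian K d n) :
    Matrix (Fin n) (Fin d) K :=
  Matrix.of fun r k => (Module.finBasisOfFinrankEq K U.1 U.2 k : Fin n → K) r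

theorem linearIndependent_basisMatrix {K : Type*} [Field K] {d n : ℕ} (U : Grassmannian K d n) :
    LinearIndependent K (basisMatrix U).col :=
  (Module.finBasisOfFinrankEq K U.1 U.2).linearIndependent.map' U.1.subtype
    (Submodule.ker_subtype _)

/-- The Plücker embedding `p : G_{d,n} → ℙ(⋀^d K^n)`, in the Plücker coordinates indexed by
`I_{d,n}`. -/
def plucker {K : Type*} [Field K] {d n : ℕ} (U : Grassmannian K d n) : ℙ K (Idx d n → K) :=
  Projectivization.mk K (minors (basisMatrix U)) (minors_ne_zero (linearIndependent_basisMatrix U))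

/-- The Plücker coordinates of `U` can be computed from any matrix which represents `U`. -/
theorem plucker_ofMatrix {K : Type*} [Field K] {d n : ℕ} (A : Matrix (Fin n) (Fin d) K)
    (hA : LinearIndependent K A.col) :
    plucker (ofMatrix A hA) = Projectivization.mk K (minors A) (minors_ne_zero hA) := by
  set U := ofMatrix A hA
  rw [plucker, Projectivization.mk_eq_mk_iff']
  let b := Module.finBasisOfFinrankEq K U.1 U.2
  let a := Module.Basis.span hA
  refine ⟨(a.toMatrix b).det, ?_⟩
  have hm : basisMatrix U = A * a.toMatrix b := by
    ext r k
    have h := congrArg (fun z : U.1 => (z : Fin n → K) r) (a.sum_toMatrix_smul_self b k)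
    have ha : ∀ l, ((a l : U.1) : Fin n → K) = A.col l := fun l => by
      simp [a, Module.Basis.span_apply]
    simp only [AddSubmonoidClass.coe_finsetSum, Finset.sum_apply] at h
    rw [Matrix.mul_apply]
    refine h.symm.trans (Finset.sum_congr rfl fun l _ => ?_)
    change a.toMatrix b l k * ((a l : U.1) : Fin n → K) r = _
    rw [ha, Matrix.col_apply, mul_comm]
  funext i
  simp only [Pi.smul_apply, smul_eq_mul, minors, hm]
  have : (A * a.toMatrix b).submatrix i.entry id = A.submatrix i.entry id * a.toMatrix b := by
    ext; rfl
  rw [this, Matrix.det_mul, mul_comm]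

/-- The Grassmannian as a (closed) subvariety of `ℙ(⋀^d K^n)`. -/
def grassmannianVariety (K : Type*) [Field K] (d n : ℕ) : Set (ℙ K (Idx d n → K)) :=
  Set.range plucker

/-! ### Schubert and Richardson varieties, torus fixed points -/

/-- The Schubert variety `X_i`, defined by `dim (U ∩ ⟨e_1, …, e_{i_t}⟩) ≥ t` for `1 ≤ t ≤ d`. The
index `t` of the text is `t + 1` here. -/
def schubert (K : Type*) [Field K] {d n : ℕ} (i : Idx d n) : Set (Grassmannian K d n) :=
  {U | ∀ t : Fin d, (t : ℕ) + 1 ≤ Module.finrank K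
    ↥(U.1 ⊓ Submodule.span K ((fun m => Pi.single m (1 : K)) '' Set.Iic (i.entry t)))}

/-- The opposite Schubert variety `X^i`, defined by
`dim (U ∩ ⟨e_n, e_{n-1}, …, e_{i_{d-t+1}}⟩) ≥ t` for `1 ≤ t ≤ d`. -/
def oppositeSchubert (K : Type*) [Field K] {d n : ℕ} (i : Idx d n) : Set (Grassmannian K d n) :=
  {U | ∀ t : Fin d, (t : ℕ) + 1 ≤ Module.finrank K
    ↥(U.1 ⊓ Submodule.span K ((fun m => Pi.single m (1 : K)) '' Set.Ici (i.entry t.rev)))}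

/-- The Richardson variety `X_i^j = X_i ∩ X^j`, as a subset of the Grassmannian. -/
def richardson (K : Type*) [Field K] {d n : ℕ} (i j : Idx d n) : Set (Grassmannian K d n) :=
  schubert K i ∩ oppositeSchubert K j

/-- The Richardson variety `X_i^j` as a (closed) subvariety of `ℙ(⋀^d K^n)`. -/
def richardsonVariety (K : Type*) [Field K] {d n : ℕ} (i j : Idx d n) :
    Set (ℙ K (Idx d n → K)) :=
  plucker '' richardson K i j

theorem richardsonVariety_subset (K : Type*) [Field K] {d n : ℕ} (i j : Idx d n) :
    richardsonVariety K i j ⊆ grassmannianVariety K d n :=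
  Set.image_subset_range _ _

/-- The `n × d` matrix with columns the standard basis vectors `e_{i_1}, …, e_{i_d}`. -/
def fixedMatrix (K : Type*) [Field K] {d n : ℕ} (i : Idx d n) : Matrix (Fin n) (Fin d) K :=
  Matrix.of fun r k => (Pi.single (i.entry k) 1 : Fin n → K) r

theorem entry_strictMono {d n : ℕ} (i : Idx d n) : StrictMono i.entry :=
  OrderEmbedding.strictMono (show Fin d ↪o Fin n from i)

theorem linearIndependent_fixedMatrix (K : Type*) [Field K] {d n : ℕ} (i : Idx d n) :
    LinearIndependent K (fixedMatrix K i).col := by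
  have h := (Pi.basisFun K (Fin n)).linearIndependent.comp i.entry (entry_strictMono i).injective
  have : (fixedMatrix K i).col = Pi.basisFun K (Fin n) ∘ i.entry := by
    funext k r
    simp [fixedMatrix]
  rw [this]
  exact h

/-- The torus fixed point `e_i = ⟨e_{i_1}, …, e_{i_d}⟩` of the Grassmannian. -/
def fixedPoint (K : Type*) [Field K] {d n : ℕ} (i : Idx d n) : Grassmannian K d n :=
  ofMatrix (fixedMatrix K i) (linearIndependent_fixedMatrix K i)

theorem le_finrank_fixedPoint {K : Type*} [Field K] {d n : ℕ} (i : Idx d n) (s : Finset (Fin d))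
    (S : Set (Fin n)) (h : ∀ k ∈ s, i.entry k ∈ S) : s.card ≤ Module.finrank K
      ↥((fixedPoint K i).1 ⊓ Submodule.span K ((fun m => Pi.single m (1 : K)) '' S)) := by
  have hli := (linearIndependent_fixedMatrix K i).comp (fun k : s => (k : Fin d))
    Subtype.val_injective
  have h1 := finrank_span_eq_card hli
  rw [Fintype.card_coe] at h1
  rw [← h1]
  apply Submodule.finrank_mono
  rw [Submodule.span_le]
  rintro _ ⟨k, rfl⟩
  refine ⟨Submodule.subset_span ⟨k, rfl⟩, Submodule.subset_span ⟨i.entry k, h k k.2, ?_⟩⟩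
  funext r
  rfl

/-- `e_k ∈ X_i^j` when `i ≥ k ≥ j`. -/
theorem fixedPoint_mem_richardson (K : Type*) [Field K] {d n : ℕ} {i k j : Idx d n} (hki : k ≤ i)
    (hjk : j ≤ k) : fixedPoint K k ∈ richardson K i j := by
  constructor
  · intro t
    refine le_trans (le_of_eq ?_) (le_finrank_fixedPoint k (Finset.Iic t) _ fun l hl =>
      Set.mem_Iic.mpr (((entry_strictMono k).monotone (Finset.mem_Iic.mp hl)).trans (hki t)))
    simp
  · intro t
    refine le_trans (le_of_eq ?_) (le_finrank_fixedPoint k (Finset.Ici t.rev) _ fun l hl =>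
      Set.mem_Ici.mpr ((hjk t.rev).trans ((entry_strictMono k).monotone (Finset.mem_Ici.mp hl))))
    simp [Fin.val_rev]
    omega

/-- `e_k` as a point of the variety `G_{d,n}`. -/
def grassmannianPoint (K : Type*) [Field K] {d n : ℕ} (k : Idx d n) : grassmannianVariety K d n :=
  ⟨plucker (fixedPoint K k), Set.mem_range_self _⟩

/-- `e_k` as a point of the variety `X_i^j`, where `i ≥ k ≥ j`. -/
def richardsonPoint (K : Type*) [Field K] {d n : ℕ} {i k j : Idx d n} (hki : k ≤ i)
    (hjk : j ≤ k) : richardsonVariety K i j :=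
  ⟨plucker (fixedPoint K k), Set.mem_image_of_mem _ (fixedPoint_mem_richardson K hki hjk)⟩

/-! ### Tangent vectors given by the action of the Lie algebra -/

/-- The Plücker coordinates of `(1 + t M) e_k`, as polynomials in `t`. -/
def orbitCurve {K : Type*} [Field K] {d n : ℕ} (M : Matrix (Fin n) (Fin n) K) (k : Idx d n) :
    Idx d n → Polynomial K :=
  minors ((1 + (Polynomial.X : Polynomial K) • M.map Polynomial.C)
    * (fixedMatrix K k).map Polynomial.C)

theorem isCurveIn_orbitCurve {K : Type*} [Field K] {d n : ℕ} (M : Matrix (Fin n) (Fin n) K)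
    (k : Idx d n) :
    IsCurveIn (grassmannianVariety K d n) (grassmannianPoint K k) (orbitCurve M k) := by
  have hev : ∀ t : K, (fun i => (orbitCurve M k i).eval t)
      = minors ((1 + t • M) * fixedMatrix K k) := by
    intro t
    funext i
    rw [orbitCurve, minors, minors, ← Polynomial.coe_evalRingHom, RingHom.map_det]
    congr 1
    ext r l
    simp only [RingHom.mapMatrix_apply, Matrix.map_apply, Matrix.submatrix_apply,
      Matrix.mul_apply, Polynomial.coe_evalRingHom, Polynomial.eval_finsetSum]
    refine Finset.sum_congr rfl fun x _ => ?_
    simp [Matrix.one_apply, apply_ite]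
    exact Or.inl (mul_comm _ _)
  have hli : ∀ t : K, (1 + t • M).det ≠ 0 →
      LinearIndependent K ((1 + t • M) * fixedMatrix K k).col := by
    intro t ht
    rw [← Matrix.mulVec_injective_iff]
    have h1 : Function.Injective (1 + t • M).mulVec := Matrix.mulVec_injective_iff_isUnit.mpr
      ((Matrix.isUnit_iff_isUnit_det _).mpr (isUnit_iff_ne_zero.mpr ht))
    have h2 := Matrix.mulVec_injective_iff.mpr (linearIndependent_fixedMatrix K k)
    intro u v huv
    simp only [← Matrix.mulVec_mulVec] at huv
    exact h2 (h1 huv)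
  constructor
  · refine ⟨(1 + (Polynomial.X : Polynomial K) • M.map Polynomial.C).det, ?_, ?_⟩
    · intro h
      have := congrArg (Polynomial.eval 0) h
      rw [← Polynomial.coe_evalRingHom, RingHom.map_det] at this
      have h1 : (Polynomial.evalRingHom (0 : K)).mapMatrix
          (1 + (Polynomial.X : Polynomial K) • M.map Polynomial.C) = 1 := by
        ext r l
        simp [Matrix.one_apply, apply_ite]
      rw [h1] at this
      simp at this
    · intro t ht
      have h1 : (Polynomial.evalRingHom t).mapMatrix
          (1 + (Polynomial.X : Polynomial K) • M.map Polynomial.C) = 1 + t • M := by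
        ext r l
        simp [Matrix.one_apply, apply_ite]
        ring
      rw [← Polynomial.coe_evalRingHom, RingHom.map_det, h1] at ht
      simp only [hev]
      exact ⟨minors_ne_zero (hli t ht), ofMatrix _ (hli t ht), plucker_ofMatrix _ _⟩
  · simp only [hev]
    have h0 : (1 + (0 : K) • M) * fixedMatrix K k = fixedMatrix K k := by simp
    simp only [h0]
    exact ⟨minors_ne_zero (linearIndependent_fixedMatrix K k), (plucker_ofMatrix _ _).symm⟩

/-- The tangent vector at `e_k` to the Grassmannian given by an element `M` of the Lie algebra
`𝔤 = 𝔰𝔩_n`: the image of `M` under the differential at `1` of the orbit map `g ↦ g e_k`, that is,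
the velocity at `t = 0` of `(1 + t M) e_k`. -/
def orbitTangent {K : Type*} [Field K] [Infinite K] {d n : ℕ}
    (M : LieAlgebra.SpecialLinear.sl (Fin n) K) (k : Idx d n) :
    tangentSpace (grassmannianVariety K d n) (grassmannianPoint K k) :=
  velocity (isCurveIn_orbitCurve M.1 k)

/-! ### Roots and the Weyl group -/

/-- The root `ε_i - ε_j`, `i ≠ j`, of `SL_n` relative to the torus of diagonal matrices. -/
@[ext]
structure Root (n : ℕ) where
  /-- The index `i` of `ε_i - ε_j`. -/
  i : Fin n
  /-- The index `j` of `ε_i - ε_j`. -/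
  j : Fin n
  ne : i ≠ j

/-- The root `-α`. -/
def Root.neg {n : ℕ} (α : Root n) : Root n := ⟨α.j, α.i, α.ne.symm⟩

/-- The action of the Weyl group `W = S_n` on roots. -/
def Root.act {n : ℕ} (σ : Equiv.Perm (Fin n)) (α : Root n) : Root n :=
  ⟨σ α.i, σ α.j, fun h => α.ne (σ.injective h)⟩

/-- The reflection `s_α ∈ W = S_n`. -/
def Root.reflection {n : ℕ} (α : Root n) : Equiv.Perm (Fin n) := Equiv.swap α.i α.j

/-- The root vector `X_α = E_{ij}`, `α = ε_i - ε_j`, of the Chevalley basis of `𝔰𝔩_n`. -/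
def Root.vector {n : ℕ} (K : Type*) [Field K] (α : Root n) :
    LieAlgebra.SpecialLinear.sl (Fin n) K :=
  LieAlgebra.SpecialLinear.single α.i α.j α.ne 1

/-- The positive roots `R^+`, relative to the upper triangular matrices. -/
def positiveRoots (n : ℕ) : Set (Root n) := {α | α.i < α.j}

/-- The roots `R_P` of (the Levi part of) the maximal parabolic subgroup `P = P_d`, whose Weyl
group is `S_d × S_{n-d}`. -/
def parabolicRoots (d n : ℕ) : Set (Root n) := {α | (α.i : ℕ) < d ↔ (α.j : ℕ) < d}

/-- `R_P^+`. -/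
def positiveParabolicRoots (d n : ℕ) : Set (Root n) := positiveRoots n ∩ parabolicRoots d n

/-- The set `W^P` of minimal representatives of `W / W_P`: permutations with
`σ(1) < ⋯ < σ(d)` and `σ(d+1) < ⋯ < σ(n)`. -/
def minReps (d n : ℕ) : Set (Equiv.Perm (Fin n)) :=
  {σ | ∀ a b : Fin n, a < b → ((a : ℕ) < d ↔ (b : ℕ) < d) → σ a < σ b}

/-- The class of `σ ∈ W` in `W / W_P`, identified with `I_{d,n}`: the set `{σ(1), …, σ(d)}`
arranged in increasing order. -/
def cosetIdx {d n : ℕ} (hdn : d < n) (σ : Equiv.Perm (Fin n)) : Idx d n :=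
  (Finset.univ.image fun t : Fin d => σ (Fin.castLE hdn.le t)).orderEmbOfFin (by
    refine (Finset.card_image_of_injective _
      (σ.injective.comp (Fin.castLE_injective hdn.le))).trans ?_
    rw [Finset.card_univ, Fintype.card_fin])

/-- The relation `ρ ≥ σ (mod W_P)` on `W`: the order of the classes in `W / W_P = I_{d,n}`. -/
abbrev CosetLE {d n : ℕ} (hdn : d < n) (σ ρ : Equiv.Perm (Fin n)) : Prop :=
  cosetIdx hdn σ ≤ cosetIdx hdn ρ

/-- The set of the roots `β ∈ τ(R^+ ∖ R_P^+)` such that `w ≥ s_β τ ≥ v (mod W_P)`. -/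
def tangentRoots {d n : ℕ} (hdn : d < n) (w τ v : Equiv.Perm (Fin n)) : Set (Root n) :=
  {β | β ∈ Root.act τ '' (positiveRoots n \ positiveParabolicRoots d n) ∧
    CosetLE hdn (β.reflection * τ) w ∧ CosetLE hdn v (β.reflection * τ)}

/-- `T_{w,τ}^v`: the Zariski tangent space to `X_w^v` at `e_τ`, where `w ≥ τ ≥ v`. -/
abbrev richardsonTangentSpace (K : Type*) [Field K] {d n : ℕ} (hdn : d < n)
    {w τ v : Equiv.Perm (Fin n)} (hτw : CosetLE hdn τ w) (hvτ : CosetLE hdn v τ) :=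
  tangentSpace (richardsonVariety K (cosetIdx hdn w) (cosetIdx hdn v))
    (richardsonPoint K hτw hvτ)

/-- The inclusion of `T_{w,τ}^v` in the tangent space to the Grassmannian at `e_τ`, the
differential of the inclusion of `X_w^v` in the Grassmannian. -/
def richardsonTangentInclusion (K : Type*) [Field K] {d n : ℕ} (hdn : d < n)
    {w τ v : Equiv.Perm (Fin n)} (hτw : CosetLE hdn τ w) (hvτ : CosetLE hdn v τ) :
    richardsonTangentSpace K hdn hτw hvτ →ₗ[K]
      tangentSpace (grassmannianVariety K d n) (grassmannianPoint K (cosetIdx hdn τ)) :=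
  tangentInclusion (richardsonVariety_subset K (cosetIdx hdn w) (cosetIdx hdn v))
    (richardsonPoint K hτw hvτ)

/-- The root vector `X_α ∈ 𝔤` as a tangent vector to the Grassmannian at `e_τ`. -/
def rootTangent (K : Type*) [Field K] [Infinite K] {d n : ℕ} (hdn : d < n)
    (τ : Equiv.Perm (Fin n)) (α : Root n) :
    tangentSpace (grassmannianVariety K d n) (grassmannianPoint K (cosetIdx hdn τ)) :=
  orbitTangent (α.vector K) (cosetIdx hdn τ)

end

end Richardson

open Richardson

namespace Richardson

noncomputable section

/-! ### Derivations of the local ring and homogeneous coordinates -/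

/-! Let k be the index set of the coset of τ, so that e_τ = e_k. The proof bounds the tangent space
above by vanishing Plücker coordinates and below by explicit lines, and the two bounds agree. No
knowledge of generators of the ideal of X_w^v is needed.

Upper bound: a tangent vector D at e_k is determined by its values on the functions p_i/p_k
(`tangentSpace_ext`). It kills p_k/p_k = 1. If i has two entries outside k, then on the chart p_k ≠
0 the function p_i/p_k is a determinant with two rows vanishing at e_k, so it lies in the square of
the maximal ideal and D kills it (`tangentSpace_affineCoord_eq_zero`). Finally p_i vanishes on X_w^v
unless v ≤ i ≤ w, by the rank conditions (`richardsonVariety_rep`). Only those i remain which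
satisfy v ≤ i ≤ w and arise from k by exchanging one entry k_a for some j outside k.

Lower bound: for such an i, the curve t ↦ (1 + tE_{j,k_a})e_k is an affine line in Plücker
coordinates. It runs inside X_w^v because the rank conditions valid at e_k and e_i persist along it
(`le_finrank_shear`). Its velocity takes the value ±1 on p_i/p_k and 0 on every other p_{i'}/p_k, in
every characteristic, so these velocities form a dual basis up to sign.

Dictionary: the roots β in τ(R^+ ∖ R_P^+) are the ε_{k_a} - ε_j with j outside k. The coset of s_β τ
is the exchanged index set, and X_{-β} = E_{j,k_a}. -/

/-- The evaluation `𝒪_{X,x} → K` as a ring homomorphism. -/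
def valueHom {K ι : Type*} [Field K] {X : Set (ℙ K (ι → K))} {x : X} : localRing X x →+* K :=
  Germ.valueRingHom.comp (localRing X x).val.toRingHom

theorem valueHom_apply {K ι : Type*} [Field K] {X : Set (ℙ K (ι → K))} {x : X}
    (f : localRing X x) : valueHom f = value f := rfl

/-- The germ at `x` of the quotient of two homogeneous polynomials. -/
def fraction {K ι : Type*} [Field K] {X : Set (ℙ K (ι → K))} {x : X} {m : ℕ}
    {P Q : MvPolynomial ι K} (hP : P.IsHomogeneous m) (hQ : Q.IsHomogeneous m)
    (h0 : MvPolynomial.eval x.1.rep Q ≠ 0) : localRing X x :=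
  ⟨((fun y : X => ratio P Q y.1) : Germ (𝓝 x) K), m, P, Q, hP, hQ, h0, rfl⟩

/-- The germ at `x` of the affine coordinate `y_i / y_k`. -/
def affineCoord {K ι : Type*} [Field K] {X : Set (ℙ K (ι → K))} {x : X} {k : ι}
    (hk : x.1.rep k ≠ 0) (i : ι) : localRing X x :=
  fraction (MvPolynomial.isHomogeneous_X K i) (MvPolynomial.isHomogeneous_X K k) (by simpa using hk)

theorem coe_aeval_affineCoord {K ι : Type*} [Field K] {X : Set (ℙ K (ι → K))} {x : X} {k : ι}
    (hk : x.1.rep k ≠ 0) (P : MvPolynomial ι K) :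
    (MvPolynomial.aeval (affineCoord hk) P).1
      = ((fun y : X => MvPolynomial.eval (fun i => y.1.rep i / y.1.rep k) P) : Germ (𝓝 x) K) := by
  induction P using MvPolynomial.induction_on with
  | C a =>
    simp only [MvPolynomial.aeval_C, MvPolynomial.eval_C]
    exact algebraMap_germ a
  | add p q hp hq =>
    simp only [map_add, AddMemClass.coe_add, hp, hq]
    rfl
  | mul_X p i hp =>
    simp only [map_mul, MulMemClass.coe_mul, hp, MvPolynomial.aeval_X, MvPolynomial.eval_X]
    rw [affineCoord, fraction, ← Germ.coe_mul]
    congr 1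
    funext y
    simp [ratio]

theorem value_aeval_affineCoord {K ι : Type*} [Field K] {X : Set (ℙ K (ι → K))} {x : X} {k : ι}
    (hk : x.1.rep k ≠ 0) (P : MvPolynomial ι K) :
    value (MvPolynomial.aeval (affineCoord hk) P)
      = MvPolynomial.eval (fun i => x.1.rep i / x.1.rep k) P := by
  rw [value, coe_aeval_affineCoord, Germ.value_ofFun]

theorem eval_div_of_isHomogeneous {K ι : Type*} [Field K] {m : ℕ} {P : MvPolynomial ι K}
    (hP : P.IsHomogeneous m) (u : ι → K) (a : K) :
    MvPolynomial.eval (fun i => u i / a) P = MvPolynomial.eval u P / a ^ m := by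
  have h : (fun i => u i / a) = a⁻¹ • u := by
    funext i
    simp [div_eq_inv_mul]
  rw [h, eval_smul_of_isHomogeneous hP, inv_pow, div_eq_inv_mul]

theorem tangentSpace_map_one {K ι : Type*} [Field K] {X : Set (ℙ K (ι → K))} {x : X}
    (D : tangentSpace X x) : D.1 1 = 0 := by
  have h := D.2 1 1
  have h1 : value (1 : localRing X x) = 1 := (valueHom (X := X) (x := x)).map_one
  rw [h1] at h
  simpa using h

/-- Every germ f of the local ring satisfies f · q = p with p, q polynomials in the affine
coordinates; this reduces derivations to those coordinates. -/
theorem fraction_mul_aeval {K ι : Type*} [Field K] {X : Set (ℙ K (ι → K))} {x : X} {k : ι}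
    (hk : x.1.rep k ≠ 0) {m : ℕ} {P Q : MvPolynomial ι K} (hP : P.IsHomogeneous m)
    (hQ : Q.IsHomogeneous m) (h0 : MvPolynomial.eval x.1.rep Q ≠ 0) :
    fraction hP hQ h0 * MvPolynomial.aeval (affineCoord hk) Q
      = MvPolynomial.aeval (affineCoord hk) P := by
  apply Subtype.ext
  rw [MulMemClass.coe_mul, coe_aeval_affineCoord, coe_aeval_affineCoord, fraction, ← Germ.coe_mul,
    Germ.coe_eq]
  -- Only Q(y) ≠ 0 is needed: P/Q · (Q/c) = P/c holds also for c = 0 because division by zero gives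
  -- 0.
  filter_upwards [eventually_ne hQ h0] with y hy
  simp only [Pi.mul_apply, ratio, eval_div_of_isHomogeneous hP, eval_div_of_isHomogeneous hQ]
  field_simp

/-- A tangent vector is determined by its values on the affine coordinates. -/
theorem tangentSpace_ext {K ι : Type*} [Field K] {X : Set (ℙ K (ι → K))} {x : X} {k : ι}
    (hk : x.1.rep k ≠ 0) {D E : tangentSpace X x}
    (h : ∀ i, D.1 (affineCoord hk i) = E.1 (affineCoord hk i)) : D = E := by
  have hpoly : ∀ P : MvPolynomial ι K, D.1 (MvPolynomial.aeval (affineCoord hk) P)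
      = E.1 (MvPolynomial.aeval (affineCoord hk) P) := by
    intro P
    induction P using MvPolynomial.induction_on with
    | C a =>
      rw [MvPolynomial.aeval_C, Algebra.algebraMap_eq_smul_one, map_smul, map_smul,
        tangentSpace_map_one, tangentSpace_map_one]
    | add p q hp hq => rw [map_add, map_add, map_add, hp, hq]
    | mul_X p i hp => rw [map_mul, MvPolynomial.aeval_X, D.2, E.2, hp, h]
  apply Subtype.ext
  apply LinearMap.ext
  rintro ⟨f, m, P, Q, hP, hQ, h0, rfl⟩
  have hv : value (MvPolynomial.aeval (affineCoord hk) Q) ≠ 0 := by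
    rw [value_aeval_affineCoord, eval_div_of_isHomogeneous hQ]
    exact div_ne_zero h0 (pow_ne_zero _ hk)
  -- Differentiate f · q = p: D and E agree on p and on q, and q(x) ≠ 0 can be cancelled.
  have h1 := hpoly P
  rw [← fraction_mul_aeval hk hP hQ h0, D.2, E.2, hpoly Q] at h1
  exact mul_right_cancel₀ hv (add_right_cancel h1)

/-- Expand along row r: each entry vanishes at x, and so does its cofactor, which still contains row
s. Each term is thus a product of two functions vanishing at x, killed by the Leibniz rule. -/
theorem tangentSpace_map_det {K ι : Type*} [Field K] {X : Set (ℙ K (ι → K))} {x : X}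
    (D : tangentSpace X x) {d : ℕ} (M : Matrix (Fin d) (Fin d) (localRing X x)) {r s : Fin d}
    (hrs : r ≠ s) (hr : ∀ c, value (M r c) = 0) (hs : ∀ c, value (M s c) = 0) :
    D.1 M.det = 0 := by
  rw [Matrix.det_eq_sum_mul_adjugate_row M r, map_sum]
  refine Finset.sum_eq_zero fun c _ => ?_
  have h : value (M.adjugate c r) = 0 := by
    rw [← valueHom_apply, Matrix.adjugate_apply, RingHom.map_det]
    refine Matrix.det_eq_zero_of_row_eq_zero s fun l => ?_
    rw [RingHom.mapMatrix_apply, Matrix.map_apply, Matrix.updateRow_ne hrs.symm]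
    exact hs l
  rw [D.2, h, hr]
  simp

/-- `velocity` is defined through a chosen numerator and denominator; this frees it from the choice.
-/
theorem velocity_fraction {K ι : Type*} [Field K] [Infinite K] {X : Set (ℙ K (ι → K))} {x : X}
    {c : ι → Polynomial K} (hc : IsCurveIn X x c) {m : ℕ} {P Q : MvPolynomial ι K}
    (hP : P.IsHomogeneous m) (hQ : Q.IsHomogeneous m) (h0 : MvPolynomial.eval x.1.rep Q ≠ 0) :
    (velocity hc).1 (fraction hP hQ h0) = curveDeriv c P Q := by
  obtain ⟨hP', hQ', h0', hf'⟩ :=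
    (fraction (x := x) hP hQ h0).2.choose_spec.choose_spec.choose_spec
  exact curveDeriv_congr hc hP' hQ' h0' hP hQ h0 hf'.symm

theorem tangentInclusion_velocity {K ι : Type*} [Field K] [Infinite K] {X Y : Set (ℙ K (ι → K))}
    (h : X ⊆ Y) {x : X} {c : ι → Polynomial K} (hc : IsCurveIn X x c)
    (hc' : IsCurveIn Y ⟨x.1, h x.2⟩ c) : tangentInclusion h x (velocity hc) = velocity hc' := by
  apply Subtype.ext
  apply LinearMap.ext
  rintro ⟨f, m, P, Q, hP, hQ, h0, rfl⟩
  exact (velocity_fraction hc hP hQ h0).trans (velocity_fraction hc' hP hQ h0).symm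

/-! ### Index sets -/

theorem Idx.ext_range {d n : ℕ} {i j : Idx d n} (h : Set.range i.entry = Set.range j.entry) :
    i = j :=
  DFunLike.coe_injective (F := Fin d ↪o Fin n)
    (((entry_strictMono i).range_inj (entry_strictMono j)).mp h)

/-- By counting: i has exactly d entries, while f takes at most d values, whether or not it is
injective. -/
theorem Idx.range_eq_of_subset {d n : ℕ} (i : Idx d n) {f : Fin d → Fin n}
    (h : Set.range i.entry ⊆ Set.range f) : Set.range i.entry = Set.range f := by
  refine Set.eq_of_subset_of_ncard_le h ?_ (Set.finite_range f)
  rw [Set.ncard_range_of_injective (entry_strictMono i).injective, ← Set.image_univ]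
  exact (Set.ncard_image_le).trans (by simp [Set.ncard_univ])

theorem exists_idx_range_eq {d n : ℕ} {f : Fin d → Fin n} (hf : Function.Injective f) :
    ∃ (i : Idx d n) (σ : Equiv.Perm (Fin d)), f = i.entry ∘ σ := by
  have hs : (Finset.univ.image f).card = d := by
    rw [Finset.card_image_of_injective _ hf, Finset.card_univ, Fintype.card_fin]
  let i : Idx d n := (Finset.univ.image f).orderEmbOfFin hs
  have hr : Set.range i.entry = Set.range f := by
    change Set.range ((Finset.univ.image f).orderEmbOfFin hs) = _
    rw [Finset.range_orderEmbOfFin]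
    simp
  have h : ∀ a, ∃ b, i.entry b = f a := fun a => by
    have : f a ∈ Set.range i.entry := hr ▸ Set.mem_range_self a
    exact this
  choose σ hσ using h
  have hinj : Function.Injective σ := fun a b hab => hf (by rw [← hσ, ← hσ, hab])
  exact ⟨i, Equiv.ofBijective σ (Finite.injective_iff_bijective.mp hinj),
    funext fun a => (hσ a).symm⟩

/-! ### Plücker coordinates -/

/-- A minor of an `n × d` matrix on an arbitrary sequence of rows is, up to sign, a Plücker
coordinate or zero. -/
theorem exists_minor_eq (K : Type*) [Field K] {d n : ℕ} (f : Fin d → Fin n) :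
    ∃ P : MvPolynomial (Idx d n) K, ∀ A : Matrix (Fin n) (Fin d) K,
      MvPolynomial.eval (minors A) P = (A.submatrix f id).det := by
  by_cases hf : Function.Injective f
  · obtain ⟨i, σ, rfl⟩ := exists_idx_range_eq hf
    refine ⟨MvPolynomial.C ((Equiv.Perm.sign σ : ℤ) : K) * MvPolynomial.X i, fun A => ?_⟩
    rw [map_mul, MvPolynomial.eval_C, MvPolynomial.eval_X, minors, ← Matrix.det_permute]
    rfl
  · simp only [Function.Injective, not_forall] at hf
    obtain ⟨a, b, hab, hne⟩ := hf
    refine ⟨0, fun A => ?_⟩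
    rw [map_zero, Matrix.det_zero_of_row_eq hne]
    funext c
    simp [hab]

theorem minors_mul {R : Type*} [CommRing R] {d n : ℕ} (A : Matrix (Fin n) (Fin d) R)
    (B : Matrix (Fin d) (Fin d) R) (i : Idx d n) : minors (A * B) i = minors A i * B.det := by
  rw [minors, minors, ← Matrix.det_mul]
  rfl

/-- Over the open set where the coordinate `k` does not vanish, a point of the Grassmannian is
represented by a matrix whose submatrix with rows `k` is the identity. -/
theorem exists_normalized {K : Type*} [Field K] {d n : ℕ} {y : ℙ K (Idx d n → K)}
    (hy : y ∈ grassmannianVariety K d n) {k : Idx d n} (hk : y.rep k ≠ 0) :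
    ∃ B : Matrix (Fin n) (Fin d) K, B.submatrix k.entry id = 1 ∧
      (fun i => y.rep i / y.rep k) = minors B := by
  obtain ⟨U, rfl⟩ := hy
  obtain ⟨a, ha⟩ := Projectivization.exists_smul_eq_mk_rep K _
    (minors_ne_zero (linearIndependent_basisMatrix U))
  set A := basisMatrix U
  have hrep : ∀ i, (plucker U).rep i = a * minors A i := fun i => (congrFun ha i).symm
  have hAk : minors A k ≠ 0 := by
    rw [hrep] at hk
    exact right_ne_zero_of_mul hk
  have hu : IsUnit (A.submatrix k.entry id).det := isUnit_iff_ne_zero.mpr hAk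
  -- Changing the basis of U by the inverse of the block with rows k divides every Plücker
  -- coordinate by p_k.
  refine ⟨A * (A.submatrix k.entry id)⁻¹, ?_, ?_⟩
  · have : (A * (A.submatrix k.entry id)⁻¹).submatrix k.entry id
        = A.submatrix k.entry id * (A.submatrix k.entry id)⁻¹ := by
      ext; rfl
    rw [this, Matrix.mul_nonsing_inv _ hu]
  · funext i
    rw [minors_mul, Matrix.det_nonsing_inv, hrep, hrep, mul_div_mul_left _ _ a.ne_zero,
      Ring.inverse_eq_inv', div_eq_mul_inv]
    rfl

/-- Cramer's rule for the identity matrix with one row replaced. It shows that the entries of a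
normalized matrix are themselves minors, hence regular functions on the chart. -/
theorem det_submatrix_update {K : Type*} [Field K] {d n : ℕ} {B : Matrix (Fin n) (Fin d) K}
    {k : Idx d n} (hB : B.submatrix k.entry id = 1) (r : Fin n) (c : Fin d) :
    (B.submatrix (Function.update k.entry c r) id).det = B r c := by
  have : B.submatrix (Function.update k.entry c r) id
      = (1 : Matrix (Fin d) (Fin d) K).updateRow c (B r) := by
    rw [← hB]
    ext a b
    by_cases h : a = c
    · subst h; simp
    · simp [h]
  rw [this]
  have h := Matrix.cramer_transpose_apply (1 : Matrix (Fin d) (Fin d) K) (B r) c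
  rw [← h]
  simp

theorem fixedMatrix_apply (K : Type*) [Field K] {d n : ℕ} (k : Idx d n) (r : Fin n) (c : Fin d) :
    fixedMatrix K k r c = if r = k.entry c then 1 else 0 := by
  simp [fixedMatrix, Pi.single_apply]

theorem fixedMatrix_submatrix (K : Type*) [Field K] {d n : ℕ} (k : Idx d n) :
    (fixedMatrix K k).submatrix k.entry id = 1 := by
  ext a b
  simp [fixedMatrix_apply, Matrix.one_apply, (entry_strictMono k).injective.eq_iff]

/-- The representative `rep` is known only up to a scalar; dividing by the coordinate k, which is 1
on `fixedMatrix K k`, removes it. -/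
theorem plucker_fixedPoint_rep (K : Type*) [Field K] {d n : ℕ} (k : Idx d n) :
    (plucker (fixedPoint K k)).rep k ≠ 0 ∧
      (fun i => (plucker (fixedPoint K k)).rep i / (plucker (fixedPoint K k)).rep k)
        = minors (fixedMatrix K k) := by
  have hmk : minors (fixedMatrix K k) k = 1 := by
    rw [minors, fixedMatrix_submatrix, Matrix.det_one]
  obtain ⟨a, ha⟩ := Projectivization.exists_smul_eq_mk_rep K _
    (minors_ne_zero (linearIndependent_fixedMatrix K k))
  have hrep : ∀ i, (plucker (fixedPoint K k)).rep i = a * minors (fixedMatrix K k) i := fun i => by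
    rw [fixedPoint, plucker_ofMatrix, ← ha]
    rfl
  refine ⟨by rw [hrep, hmk, mul_one]; exact a.ne_zero, funext fun i => ?_⟩
  rw [hrep, hrep, mul_div_mul_left _ _ a.ne_zero, hmk, div_one]

/-- A tangent vector at `e_k` kills the coordinates `p_i / p_k` for which `i` has at least two
entries outside `k`. -/
theorem tangentSpace_affineCoord_eq_zero {K : Type*} [Field K] {d n : ℕ}
    {X : Set (ℙ K (Idx d n → K))} (hX : X ⊆ grassmannianVariety K d n) {x : X} {k : Idx d n}
    (hx : x.1 = plucker (fixedPoint K k)) (hk : x.1.rep k ≠ 0) (D : tangentSpace X x)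
    {i : Idx d n} {r s : Fin d} (hrs : r ≠ s) (hr : i.entry r ∉ Set.range k.entry)
    (hs : i.entry s ∉ Set.range k.entry) : D.1 (affineCoord hk i) = 0 := by
  choose P hP using exists_minor_eq K (d := d) (n := n)
  -- Evaluated at the minors of a normalized matrix B, the entry (a, c) of M becomes the entry of B
  -- in row i_a and column c, so the determinant of M becomes the minor i of B.
  let M : Matrix (Fin d) (Fin d) (MvPolynomial (Idx d n) K) :=
    Matrix.of fun a c => P (Function.update k.entry c (i.entry a))
  have hM : affineCoord hk i = (M.map (MvPolynomial.aeval (affineCoord hk))).det := by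
    have h1 : (M.map (MvPolynomial.aeval (affineCoord hk))).det
        = MvPolynomial.aeval (affineCoord hk) M.det := by
      rw [AlgHom.map_det]
      rfl
    have h2 : affineCoord hk i
        = MvPolynomial.aeval (affineCoord hk) (MvPolynomial.X i : MvPolynomial (Idx d n) K) := by
      rw [MvPolynomial.aeval_X]
    rw [h1, h2]
    apply Subtype.ext
    rw [coe_aeval_affineCoord, coe_aeval_affineCoord, Germ.coe_eq]
    filter_upwards [eventually_ne (MvPolynomial.isHomogeneous_X K k)
      (by rwa [MvPolynomial.eval_X] : MvPolynomial.eval x.1.rep (MvPolynomial.X k) ≠ 0)] with y hy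
    rw [MvPolynomial.eval_X] at hy
    obtain ⟨B, hB, hrep⟩ := exists_normalized (hX y.2) hy
    rw [hrep, RingHom.map_det, MvPolynomial.eval_X, minors]
    congr 1
    ext a c
    simp only [RingHom.mapMatrix_apply, Matrix.map_apply, M, Matrix.of_apply, hP]
    rw [det_submatrix_update hB]
    rfl
  -- At e_k the normalized matrix is `fixedMatrix K k`, whose rows outside k are zero.
  have hval : ∀ a c, i.entry a ∉ Set.range k.entry →
      value (M.map (MvPolynomial.aeval (affineCoord hk)) a c) = 0 := by
    intro a c ha
    rw [Matrix.map_apply, value_aeval_affineCoord, hx, (plucker_fixedPoint_rep K k).2]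
    simp only [M, Matrix.of_apply, hP]
    rw [det_submatrix_update (fixedMatrix_submatrix K k), fixedMatrix_apply, if_neg]
    exact fun h => ha ⟨c, h.symm⟩
  rw [hM]
  exact tangentSpace_map_det D _ hrs (fun c => hval r c hr) fun c => hval s c hs

/-! ### Rank conditions and Plücker coordinates -/

/-- Since the minor i is nonzero, a vector of U is determined by its coordinates at the entries of
i. For a vector supported on S those outside S vanish, so the coordinates i_a with a in s suffice.
-/
theorem finrank_inf_le_card {K : Type*} [Field K] {d n : ℕ} {U : Grassmannian K d n} {i : Idx d n}
    (hU : minors (basisMatrix U) i ≠ 0) (S : Set (Fin n)) (s : Finset (Fin d))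
    (hs : ∀ a, i.entry a ∈ S → a ∈ s) : Module.finrank K
      ↥(U.1 ⊓ Submodule.span K ((fun m => Pi.single m (1 : K)) '' S)) ≤ s.card := by
  let V := U.1 ⊓ Submodule.span K ((fun m => Pi.single m (1 : K)) '' S)
  let φ : V →ₗ[K] (s → K) := LinearMap.funLeft K K (fun a : s => i.entry a) ∘ₗ V.subtype
  have hφ : Function.Injective φ := by
    rw [← LinearMap.ker_eq_bot, LinearMap.ker_eq_bot']
    rintro ⟨u, huU, huS⟩ hu
    apply Subtype.ext
    change u = 0
    have hvan : ∀ m, m ∉ S → u m = 0 := by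
      intro m hm
      have hle : Submodule.span K ((fun m => Pi.single m (1 : K)) '' S)
          ≤ LinearMap.ker (LinearMap.proj m : (Fin n → K) →ₗ[K] K) := by
        rw [Submodule.span_le]
        rintro _ ⟨l, hl, rfl⟩
        have : m ≠ l := fun h => hm (h ▸ hl)
        simp [this]
      exact hle huS
    have hcoord : ∀ a, u (i.entry a) = 0 := by
      intro a
      by_cases ha : a ∈ s
      · exact congrFun hu ⟨a, ha⟩
      · exact hvan _ fun h => ha (hs a h)
    let b := Module.finBasisOfFinrankEq K U.1 U.2
    have hsum := congrArg (fun z : U.1 => (z : Fin n → K)) (b.sum_repr ⟨u, huU⟩)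
    have hmul : (basisMatrix U).mulVec (b.repr ⟨u, huU⟩) = u := by
      funext r
      have h := congrFun hsum r
      simp only [AddSubmonoidClass.coe_finsetSum, Finset.sum_apply] at h
      simp only [Matrix.mulVec, dotProduct]
      refine Eq.trans (Finset.sum_congr rfl fun c _ => ?_) h
      exact mul_comm _ _
    have hz : ((basisMatrix U).submatrix i.entry id).mulVec (b.repr ⟨u, huU⟩) = 0 := by
      funext a
      exact (congrFun hmul (i.entry a)).trans (hcoord a)
    have h0 := Matrix.eq_zero_of_mulVec_eq_zero hU hz
    rw [h0, Matrix.mulVec_zero] at hmul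
    exact hmul.symm
  have := LinearMap.finrank_le_finrank_of_injective hφ
  simpa using this

theorem le_of_mem_schubert {K : Type*} [Field K] {d n : ℕ} {U : Grassmannian K d n}
    {w i : Idx d n} (hU : U ∈ schubert K w) (hi : minors (basisMatrix U) i ≠ 0) : i ≤ w := by
  intro t
  by_contra hlt
  -- If w_t < i_t, only entries of i with index below t can be ≤ w_t. With indices starting at 0
  -- there are t of these, but the Schubert condition demands dimension t + 1.
  have h := (hU t).trans (finrank_inf_le_card hi _ (Finset.Iio t) fun a ha => by
    rw [Finset.mem_Iio, ← (entry_strictMono i).lt_iff_lt]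
    exact lt_of_le_of_lt ha (not_le.mp hlt))
  simp at h

theorem le_of_mem_oppositeSchubert {K : Type*} [Field K] {d n : ℕ} {U : Grassmannian K d n}
    {v i : Idx d n} (hU : U ∈ oppositeSchubert K v) (hi : minors (basisMatrix U) i ≠ 0) :
    v ≤ i := by
  intro t
  by_contra hlt
  -- The condition with index `t.rev` demands dimension d - t, while only d - 1 - t indices exceed
  -- t.
  have h := (hU t.rev).trans (finrank_inf_le_card hi _ (Finset.Ioi t) fun a ha => by
    rw [Finset.mem_Ioi, ← (entry_strictMono i).lt_iff_lt]
    rw [Fin.rev_rev] at ha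
    exact lt_of_lt_of_le (not_le.mp hlt) ha)
  simp [Fin.val_rev] at h
  omega

theorem richardsonVariety_rep {K : Type*} [Field K] {d n : ℕ} {w v i : Idx d n}
    {y : ℙ K (Idx d n → K)} (hy : y ∈ richardsonVariety K w v) (hi : y.rep i ≠ 0) :
    i ≤ w ∧ v ≤ i := by
  obtain ⟨U, hU, rfl⟩ := hy
  obtain ⟨a, ha⟩ := Projectivization.exists_smul_eq_mk_rep K _
    (minors_ne_zero (linearIndependent_basisMatrix U))
  have h : minors (basisMatrix U) i ≠ 0 := by
    intro h0
    apply hi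
    rw [plucker, ← ha]
    simp [h0]
  exact ⟨le_of_mem_schubert hU.1 h, le_of_mem_oppositeSchubert hU.2 h⟩

theorem tangentSpace_richardson_eq_zero {K : Type*} [Field K] {d n : ℕ} {w v k : Idx d n}
    {x : richardsonVariety K w v} (hk : x.1.rep k ≠ 0)
    (D : tangentSpace (richardsonVariety K w v) x) {i : Idx d n} (hi : ¬(i ≤ w ∧ v ≤ i)) :
    D.1 (affineCoord hk i) = 0 := by
  have : affineCoord hk i = 0 := by
    apply Subtype.ext
    change ((fun y => ratio _ _ _ : richardsonVariety K w v → K) : Germ (𝓝 x) K) = _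
    have h0 : (fun y : richardsonVariety K w v =>
        ratio (MvPolynomial.X i) (MvPolynomial.X k) y.1) = fun _ => 0 := by
      funext y
      have : y.1.rep i = 0 := by
        by_contra h
        exact hi (richardsonVariety_rep y.2 h)
      simp [ratio, this]
    rw [h0]
    rfl
  rw [this, map_zero]

/-! ### The curves `(1 + t E_{ji}) e_k` -/

/-- The matrix with columns `e_{k_c}`, except that `e_{k_a}` is replaced by `e_{k_a} + t e_j`. -/
def shear {R : Type*} [CommRing R] {d n : ℕ} (k : Idx d n) (a : Fin d) (j : Fin n) (t : R) :
    Matrix (Fin n) (Fin d) R :=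
  Matrix.of fun r c => (if r = k.entry c then 1 else 0) + if c = a ∧ r = j then t else 0

/-- The matrix with rows indexed by `i` and columns `e_{f_c}`. -/
def incidence (R : Type*) [CommRing R] {d n : ℕ} (f : Fin d → Fin n) (i : Idx d n) :
    Matrix (Fin d) (Fin d) R :=
  Matrix.of fun r c => if i.entry r = f c then 1 else 0

theorem det_incidence_eq_zero {R : Type*} [CommRing R] {d n : ℕ} {f : Fin d → Fin n} {i : Idx d n}
    (h : Set.range i.entry ≠ Set.range f) : (incidence R f i).det = 0 := by
  have h1 : ¬Set.range i.entry ⊆ Set.range f := fun h' => h (i.range_eq_of_subset h')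
  obtain ⟨_, ⟨r, rfl⟩, hr⟩ := Set.not_subset.mp h1
  refine Matrix.det_eq_zero_of_row_eq_zero r fun c => ?_
  rw [incidence, Matrix.of_apply, if_neg]
  exact fun h2 => hr ⟨c, h2.symm⟩

/-- The matrix is a column permutation of the identity, so its determinant is ±1, nonzero in every
characteristic. -/
theorem det_incidence_ne_zero {R : Type*} [CommRing R] [Nontrivial R] {d n : ℕ}
    {f : Fin d → Fin n} (hf : Function.Injective f) {i : Idx d n}
    (h : Set.range i.entry = Set.range f) : (incidence R f i).det ≠ 0 := by
  obtain ⟨l, σ, rfl⟩ := exists_idx_range_eq hf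
  obtain rfl : i = l := Idx.ext_range (h.trans (σ.surjective.range_comp _))
  have : incidence R (i.entry ∘ σ) i = (1 : Matrix (Fin d) (Fin d) R).submatrix id σ := by
    ext r c
    simp [incidence, Matrix.one_apply, (entry_strictMono i).injective.eq_iff]
  rw [this, Matrix.det_permute', Matrix.det_one, mul_one]
  rcases Int.units_eq_one_or (Equiv.Perm.sign σ) with h | h <;> simp [h]

/-- Linearity of the determinant in column a: the curve has degree at most 1 in t in Plücker
coordinates. -/
theorem minors_shear {R : Type*} [CommRing R] {d n : ℕ} (k : Idx d n) (a : Fin d) (j : Fin n)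
    (t : R) (i : Idx d n) : minors (shear k a j t) i
      = (incidence R k.entry i).det + t * (incidence R (Function.update k.entry a j) i).det := by
  have h1 : (shear k a j t).submatrix i.entry id = (incidence R k.entry i).updateCol a
      ((fun r => incidence R k.entry i r a)
        + t • fun r => incidence R (Function.update k.entry a j) i r a) := by
    ext r c
    by_cases hc : c = a
    · subst hc
      simp [shear, incidence]
    · simp [shear, incidence, hc]
  have h2 : (incidence R k.entry i).updateCol a
      (fun r => incidence R (Function.update k.entry a j) i r a)
        = incidence R (Function.update k.entry a j) i := by
    ext r c
    by_cases hc : c = a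
    · subst hc
      simp
    · simp [incidence, hc]
  rw [minors, h1, Matrix.det_updateCol_add, Matrix.det_updateCol_smul, h2]
  congr 2
  ext r c
  by_cases hc : c = a
  · subst hc
    simp
  · simp [hc]

theorem map_shear {R S : Type*} [CommRing R] [CommRing S] (φ : R →+* S) {d n : ℕ} (k : Idx d n)
    (a : Fin d) (j : Fin n) (t : R) : (shear k a j t).map φ = shear k a j (φ t) := by
  ext r c
  simp [shear, apply_ite φ]

theorem map_minors {R S : Type*} [CommRing R] [CommRing S] (φ : R →+* S) {d n : ℕ}
    (A : Matrix (Fin n) (Fin d) R) (i : Idx d n) : φ (minors A i) = minors (A.map φ) i := by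
  rw [minors, RingHom.map_det]
  rfl

theorem map_det_incidence {R S : Type*} [CommRing R] [CommRing S] (φ : R →+* S) {d n : ℕ}
    (f : Fin d → Fin n) (i : Idx d n) : φ (incidence R f i).det = (incidence S f i).det := by
  rw [RingHom.map_det]
  congr 1
  ext r c
  simp [incidence, apply_ite φ]

theorem shear_submatrix {R : Type*} [CommRing R] {d n : ℕ} {k : Idx d n} (a : Fin d) {j : Fin n}
    (hj : j ∉ Set.range k.entry) (t : R) : (shear k a j t).submatrix k.entry id = 1 := by
  ext r c
  have : k.entry r ≠ j := fun h => hj ⟨r, h⟩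
  simp [shear, this, Matrix.one_apply, (entry_strictMono k).injective.eq_iff]

theorem shear_zero (K : Type*) [Field K] {d n : ℕ} (k : Idx d n) (a : Fin d) (j : Fin n) :
    shear k a j (0 : K) = fixedMatrix K k := by
  ext r c
  simp [shear, fixedMatrix_apply]

theorem linearIndependent_shear {K : Type*} [Field K] {d n : ℕ} {k : Idx d n} (a : Fin d)
    {j : Fin n} (hj : j ∉ Set.range k.entry) (t : K) :
    LinearIndependent K (shear k a j t).col := by
  rw [← Matrix.mulVec_injective_iff]
  have h : ∀ u : Fin d → K, (shear k a j t).mulVec u ∘ k.entry = u := fun u => by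
    have : (shear k a j t).mulVec u ∘ k.entry
        = ((shear k a j t).submatrix k.entry id).mulVec u := rfl
    rw [this, shear_submatrix a hj, Matrix.one_mulVec]
  intro u u' huu
  rw [← h u, ← h u']
  exact congrArg (· ∘ k.entry) huu

/-- E_{j,k_a} sends e_{k_a} to e_j and kills the other columns e_{k_c}, so 1 + tE_{j,k_a} changes
column a only. -/
theorem orbitCurve_single (K : Type*) [Field K] {d n : ℕ} (k : Idx d n) (a : Fin d) (j : Fin n) :
    orbitCurve (Matrix.single j (k.entry a) (1 : K)) k
      = minors (shear k a j (Polynomial.X : Polynomial K)) := by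
  rw [orbitCurve]
  congr 1
  ext1 r c
  rw [Matrix.mul_apply, Finset.sum_eq_single (k.entry c)]
  · by_cases hr : r = j <;> by_cases hc : c = a <;>
      simp [fixedMatrix_apply, shear, Matrix.one_apply, Matrix.single_apply, hr, hc,
        (entry_strictMono k).injective.eq_iff, eq_comm, and_comm]
  · intro m _ hm
    simp [fixedMatrix_apply, hm]
  · simp

theorem card_le_card_filter {d n : ℕ} {l : Idx d n} {f : Fin d → Fin n}
    (h : Set.range l.entry = Set.range f) {S : Set (Fin n)} [DecidablePred (· ∈ S)]
    {s : Finset (Fin d)} (hs : ∀ c ∈ s, l.entry c ∈ S) :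
    s.card ≤ (Finset.univ.filter fun c => f c ∈ S).card := by
  have h1 : ∀ c, ∃ b, f b = l.entry c := fun c => by
    have : l.entry c ∈ Set.range f := h ▸ Set.mem_range_self c
    exact this
  choose g hg using h1
  refine Finset.card_le_card_of_injOn g (fun c hc => ?_) fun b _ c _ hbc => ?_
  · simpa [hg] using hs c hc
  · exact (entry_strictMono l).injective (by rw [← hg, ← hg, hbc])

open Classical in
/-- Rank conditions satisfied by `e_k` and `e_l`, where `l` is obtained from `k` by exchanging
`k_a` for `j`, hold along the whole line joining these points. -/
theorem le_finrank_shear {K : Type*} [Field K] {d n : ℕ} {k l : Idx d n} {a : Fin d} {j : Fin n}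
    (hj : j ∉ Set.range k.entry)
    (hl : Set.range l.entry = Set.range (Function.update k.entry a j)) (t : K)
    (s : Finset (Fin d)) (S : Set (Fin n)) (hks : ∀ c ∈ s, k.entry c ∈ S)
    (hls : ∀ c ∈ s, l.entry c ∈ S) : s.card ≤ Module.finrank K
      ↥((ofMatrix (shear k a j t) (linearIndependent_shear a hj t)).1
        ⊓ Submodule.span K ((fun m => Pi.single m (1 : K)) '' S)) := by
  have key : ∀ u : Finset (Fin d), (∀ c ∈ u, (shear k a j t).col c
      ∈ Submodule.span K ((fun m => Pi.single m (1 : K)) '' S)) → u.card ≤ Module.finrank K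
      ↥((ofMatrix (shear k a j t) (linearIndependent_shear a hj t)).1
        ⊓ Submodule.span K ((fun m => Pi.single m (1 : K)) '' S)) := by
    intro u hu
    have hli := (linearIndependent_shear a hj t).comp (fun c : u => (c : Fin d))
      Subtype.val_injective
    have h1 := finrank_span_eq_card hli
    rw [Fintype.card_coe] at h1
    rw [← h1]
    apply Submodule.finrank_mono
    rw [Submodule.span_le]
    rintro _ ⟨c, rfl⟩
    exact ⟨Submodule.subset_span ⟨c, rfl⟩, hu c c.2⟩
  have hmem : ∀ m ∈ S, (Pi.single m 1 : Fin n → K)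
      ∈ Submodule.span K ((fun m => Pi.single m (1 : K)) '' S) := fun m hm =>
    Submodule.subset_span ⟨m, hm, rfl⟩
  have hcol : ∀ c, c ≠ a → (shear k a j t).col c = Pi.single (k.entry c) 1 := fun c hc => by
    funext r
    simp [shear, hc, Pi.single_apply]
  have hcola : (shear k a j t).col a = Pi.single (k.entry a) 1 + t • Pi.single j 1 := by
    funext r
    simp [shear, Pi.single_apply]
  -- In this case the moving column may leave the span of S. The rank condition at e_l then supplies
  -- enough columns: those of l lying in S do not involve j, so they are columns unaffected by t.
  by_cases ha : k.entry a ∈ S ∧ j ∉ S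
  · refine (card_le_card_filter hl hls).trans (key _ fun c hc => ?_)
    rw [Finset.mem_filter] at hc
    have hca : c ≠ a := by
      rintro rfl
      rw [Function.update_self] at hc
      exact ha.2 hc.2
    rw [Function.update_of_ne hca] at hc
    rw [hcol c hca]
    exact hmem _ hc.2
  -- Otherwise the columns indexed by s all stay in the span: if a is in s, then k_a is in S, which
  -- forces j in S.
  · refine key s fun c hc => ?_
    by_cases hca : c = a
    · subst hca
      rw [hcola]
      have hjS : j ∈ S := by
        by_contra h
        exact ha ⟨hks c hc, h⟩
      exact Submodule.add_mem _ (hmem _ (hks c hc)) (Submodule.smul_mem _ _ (hmem _ hjS))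
    · rw [hcol c hca]
      exact hmem _ (hks c hc)

theorem shear_mem_richardson {K : Type*} [Field K] {d n : ℕ} {w v k l : Idx d n} {a : Fin d}
    {j : Fin n} (hj : j ∉ Set.range k.entry)
    (hl : Set.range l.entry = Set.range (Function.update k.entry a j)) (hkw : k ≤ w) (hvk : v ≤ k)
    (hlw : l ≤ w) (hvl : v ≤ l) (t : K) :
    ofMatrix (shear k a j t) (linearIndependent_shear a hj t) ∈ richardson K w v := by
  have hlow : ∀ {i : Idx d n}, i ≤ w → ∀ s, ∀ c ∈ Finset.Iic s, i.entry c ∈ Set.Iic (w.entry s) :=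
    fun {i} hi s c hc => ((entry_strictMono i).monotone (Finset.mem_Iic.mp hc)).trans (hi s)
  have hupp : ∀ {i : Idx d n}, v ≤ i → ∀ s, ∀ c ∈ Finset.Ici s, i.entry c ∈ Set.Ici (v.entry s) :=
    fun {i} hi s c hc => (hi s).trans ((entry_strictMono i).monotone (Finset.mem_Ici.mp hc))
  constructor
  · intro s
    refine le_trans (le_of_eq ?_) (le_finrank_shear hj hl t (Finset.Iic s) _ (hlow hkw s)
      (hlow hlw s))
    simp
  · intro s
    refine le_trans (le_of_eq ?_) (le_finrank_shear hj hl t (Finset.Ici s.rev) _ (hupp hvk _)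
      (hupp hvl _))
    simp [Fin.val_rev]
    omega

theorem isCurveIn_shear {K : Type*} [Field K] {d n : ℕ} {w v k l : Idx d n} {a : Fin d}
    {j : Fin n} (hj : j ∉ Set.range k.entry)
    (hl : Set.range l.entry = Set.range (Function.update k.entry a j)) (hkw : k ≤ w) (hvk : v ≤ k)
    (hlw : l ≤ w) (hvl : v ≤ l) : IsCurveIn (richardsonVariety K w v) (richardsonPoint K hkw hvk)
      (minors (shear k a j (Polynomial.X : Polynomial K))) := by
  have hev : ∀ t : K, (fun i => (minors (shear k a j (Polynomial.X : Polynomial K)) i).eval t)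
      = minors (shear k a j t) := by
    intro t
    funext i
    rw [← Polynomial.coe_evalRingHom, map_minors, map_shear, Polynomial.coe_evalRingHom,
      Polynomial.eval_X]
  constructor
  -- No parameter needs to be excluded: the rows k of the matrix form the identity, so its rank is d
  -- for all t.
  · refine ⟨1, one_ne_zero, fun t _ => ?_⟩
    simp only [hev]
    exact ⟨minors_ne_zero (linearIndependent_shear a hj t), _,
      shear_mem_richardson hj hl hkw hvk hlw hvl t, plucker_ofMatrix _ _⟩
  · simp only [hev, shear_zero]
    exact ⟨minors_ne_zero (linearIndependent_fixedMatrix K k), (plucker_ofMatrix _ _).symm⟩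

/-- Along the curve p_k is constantly 1, so the derivative of p_i/p_k is the coefficient of t in
p_i. -/
theorem curveDeriv_shear {K : Type*} [Field K] {d n : ℕ} {k : Idx d n} (a : Fin d) {j : Fin n}
    (hj : j ∉ Set.range k.entry) (i : Idx d n) :
    curveDeriv (minors (shear k a j (Polynomial.X : Polynomial K))) (MvPolynomial.X i)
      (MvPolynomial.X k) = (incidence K (Function.update k.entry a j) i).det := by
  have h1 : minors (shear k a j (Polynomial.X : Polynomial K)) k = 1 := by
    rw [minors, shear_submatrix a hj, Matrix.det_one]
  simp only [curveDeriv, MvPolynomial.aeval_X, h1]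
  rw [minors_shear, ← map_det_incidence Polynomial.C, ← map_det_incidence Polynomial.C]
  simp

/-! ### Exchange of one index -/

theorem mem_range_update {d n : ℕ} (k : Idx d n) (a : Fin d) (j m : Fin n) :
    m ∈ Set.range (Function.update k.entry a j) ↔
      m = j ∨ m ∈ Set.range k.entry ∧ m ≠ k.entry a := by
  constructor
  · rintro ⟨c, rfl⟩
    by_cases hc : c = a
    · subst hc
      simp
    · rw [Function.update_of_ne hc]
      exact Or.inr ⟨⟨c, rfl⟩, fun h => hc ((entry_strictMono k).injective h)⟩
  · rintro (rfl | ⟨⟨c, rfl⟩, hm⟩)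
    · exact ⟨a, Function.update_self ..⟩
    · exact ⟨c, Function.update_of_ne (fun h => hm (by rw [h])) ..⟩

theorem update_injective {d n : ℕ} {k : Idx d n} (a : Fin d) {j : Fin n}
    (hj : j ∉ Set.range k.entry) : Function.Injective (Function.update k.entry a j) := by
  intro b c hbc
  by_cases hb : b = a <;> by_cases hc : c = a
  · rw [hb, hc]
  · subst hb
    rw [Function.update_self, Function.update_of_ne hc] at hbc
    exact absurd ⟨c, hbc.symm⟩ hj
  · subst hc
    rw [Function.update_self, Function.update_of_ne hb] at hbc
    exact absurd ⟨b, hbc⟩ hj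
  · rw [Function.update_of_ne hb, Function.update_of_ne hc] at hbc
    exact (entry_strictMono k).injective hbc

/-- The exchanged set determines j as its only element outside k, and k_a as the only element of k
it lacks. -/
theorem exchange_unique {d n : ℕ} {k : Idx d n} {a a' : Fin d} {j j' : Fin n}
    (hj : j ∉ Set.range k.entry)
    (h : Set.range (Function.update k.entry a j) = Set.range (Function.update k.entry a' j')) :
    a = a' ∧ j = j' := by
  have h1 := (mem_range_update k a' j' j).mp (h ▸ (mem_range_update k a j j).mpr (Or.inl rfl))
  have hjj : j = j' := h1.resolve_right fun h2 => hj h2.1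
  refine ⟨?_, hjj⟩
  by_contra hne
  have h2 : k.entry a ∈ Set.range (Function.update k.entry a' j') :=
    (mem_range_update _ _ _ _).mpr
      (Or.inr ⟨⟨a, rfl⟩, fun h3 => hne ((entry_strictMono k).injective h3)⟩)
  rw [← h, mem_range_update] at h2
  rcases h2 with h2 | h2
  · exact hj ⟨a, h2⟩
  · exact h2.2 rfl

/-- An index set other than `k` with at most one entry outside `k` is obtained by an exchange. -/
theorem exists_exchange {d n : ℕ} {k i : Idx d n} (hik : i ≠ k)
    (h : ∀ r s, r ≠ s → i.entry r ∉ Set.range k.entry → i.entry s ∈ Set.range k.entry) :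
    ∃ (a : Fin d) (j : Fin n), j ∉ Set.range k.entry ∧
      Set.range i.entry = Set.range (Function.update k.entry a j) := by
  have h1 : ¬Set.range i.entry ⊆ Set.range k.entry := fun h' =>
    hik (Idx.ext_range (i.range_eq_of_subset h'))
  have h2 : ¬Set.range k.entry ⊆ Set.range i.entry := fun h' =>
    hik (Idx.ext_range (k.range_eq_of_subset h').symm)
  obtain ⟨_, ⟨r, rfl⟩, hr⟩ := Set.not_subset.mp h1
  obtain ⟨_, ⟨a, rfl⟩, ha⟩ := Set.not_subset.mp h2
  refine ⟨a, i.entry r, hr, i.range_eq_of_subset ?_⟩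
  rintro _ ⟨s, rfl⟩
  rw [mem_range_update]
  by_cases hs : r = s
  · exact Or.inl (by rw [hs])
  · exact Or.inr ⟨h r s hs hr, fun h3 => ha ⟨s, h3⟩⟩

/-! ### Cosets, reflections and roots in terms of index sets -/

theorem mem_range_cosetIdx {d n : ℕ} (hdn : d < n) (σ : Equiv.Perm (Fin n)) (m : Fin n) :
    σ m ∈ Set.range (cosetIdx hdn σ).entry ↔ (m : ℕ) < d := by
  have h : Set.range (cosetIdx hdn σ).entry
      = ↑(Finset.univ.image fun t : Fin d => σ (Fin.castLE hdn.le t)) :=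
    Finset.range_orderEmbOfFin _ _
  rw [h]
  simp only [Finset.coe_image, Finset.coe_univ, Set.image_univ, Set.mem_range,
    σ.injective.eq_iff]
  constructor
  · rintro ⟨t, rfl⟩
    exact t.2
  · intro hm
    exact ⟨⟨m, hm⟩, rfl⟩

theorem range_cosetIdx_reflection {d n : ℕ} (hdn : d < n) (τ : Equiv.Perm (Fin n)) (β : Root n)
    {a : Fin d} (ha : (cosetIdx hdn τ).entry a = β.i)
    (hj : β.j ∉ Set.range (cosetIdx hdn τ).entry) :
    Set.range (cosetIdx hdn (β.reflection * τ)).entry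
      = Set.range (Function.update (cosetIdx hdn τ).entry a β.j) := by
  ext m
  have h1 : m ∈ Set.range (cosetIdx hdn (β.reflection * τ)).entry
      ↔ Equiv.swap β.i β.j m ∈ Set.range (cosetIdx hdn τ).entry := by
    -- As s_β is an involution, m is the image under s_β τ of τ⁻¹(s_β(m)); so m lies in the new set
    -- exactly when s_β(m) lies in the old one.
    have h2 := mem_range_cosetIdx hdn (β.reflection * τ) (τ.symm (Equiv.swap β.i β.j m))
    have h3 := mem_range_cosetIdx hdn τ (τ.symm (Equiv.swap β.i β.j m))
    rw [← h3] at h2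
    simpa [Root.reflection] using h2
  rw [h1, mem_range_update, ha]
  by_cases hmi : m = β.i
  · subst hmi
    simpa [β.ne] using hj
  by_cases hmj : m = β.j
  · subst hmj
    rw [Equiv.swap_apply_right]
    exact iff_of_true ⟨a, ha⟩ (Or.inl rfl)
  · rw [Equiv.swap_apply_of_ne_of_ne hmi hmj]
    simp [hmi, hmj]

/-- The roots in R^+ ∖ R_P^+ are the ε_p - ε_q with p ≤ d < q, positivity being then automatic; and
τ maps the first d positions onto the entries of its coset. -/
theorem mem_act_image_iff {d n : ℕ} (hdn : d < n) (τ : Equiv.Perm (Fin n)) (β : Root n) :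
    β ∈ Root.act τ '' (positiveRoots n \ positiveParabolicRoots d n) ↔
      β.i ∈ Set.range (cosetIdx hdn τ).entry ∧ β.j ∉ Set.range (cosetIdx hdn τ).entry := by
  constructor
  · rintro ⟨α, ⟨hpos, hpar⟩, rfl⟩
    have h1 : ¬((α.i : ℕ) < d ↔ (α.j : ℕ) < d) := fun h => hpar ⟨hpos, h⟩
    have h2 : (α.i : ℕ) < α.j := hpos
    change τ α.i ∈ _ ∧ τ α.j ∉ _
    rw [mem_range_cosetIdx, mem_range_cosetIdx]
    omega
  · rintro ⟨hi, hj⟩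
    obtain ⟨p, hp⟩ := τ.surjective β.i
    obtain ⟨q, hq⟩ := τ.surjective β.j
    rw [← hp, mem_range_cosetIdx] at hi
    rw [← hq, mem_range_cosetIdx] at hj
    have hpq : p < q := Fin.lt_def.mpr (by omega)
    refine ⟨⟨p, q, hpq.ne⟩, ⟨hpq, fun h => hj (h.2.mp hi)⟩, ?_⟩
    ext1
    · exact hp
    · exact hq

theorem affineCoord_self {K ι : Type*} [Field K] {X : Set (ℙ K (ι → K))} {x : X} {k : ι}
    (hk : x.1.rep k ≠ 0) : affineCoord hk k = 1 := by
  apply Subtype.ext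
  change ((fun y : X => ratio _ _ y.1) : Germ (𝓝 x) K) = ((fun _ => 1 : X → K) : Germ (𝓝 x) K)
  rw [Germ.coe_eq]
  filter_upwards [eventually_ne (MvPolynomial.isHomogeneous_X K k)
    (by rwa [MvPolynomial.eval_X] : MvPolynomial.eval x.1.rep (MvPolynomial.X k) ≠ 0)] with y hy
  exact div_self hy

instance finite_root (n : ℕ) : Finite (Root n) :=
  Finite.of_injective (fun α : Root n => (α.i, α.j)) fun α β h => by
    rw [Prod.mk.injEq] at h
    exact Root.ext h.1 h.2

end

end Richardson

/-! ### The basis of the tangent space -/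

theorem mainTheorem3 {K : Type*} [Field K] [IsAlgClosed K] (d n : ℕ) (hd : 1 ≤ d) (hdn : d < n)
    (w τ v : Equiv.Perm (Fin n)) (hw : w ∈ minReps d n) (hτ : τ ∈ minReps d n)
    (hv : v ∈ minReps d n) (hτw : CosetLE hdn τ w) (hvτ : CosetLE hdn v τ) :
    (∃ b : Module.Basis (tangentRoots hdn w τ v) K (richardsonTangentSpace K hdn hτw hvτ),
      ∀ β : tangentRoots hdn w τ v,
        richardsonTangentInclusion K hdn hτw hvτ (b β) = rootTangent K hdn τ β.1.neg) ∧
    Module.finrank K (richardsonTangentSpace K hdn hτw hvτ) = (tangentRoots hdn w τ v).ncard := by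
  have : Fintype (tangentRoots hdn w τ v) := Fintype.ofFinite _
  set k := cosetIdx hdn τ
  have hroot : ∀ β : tangentRoots hdn w τ v, ∃ a, k.entry a = β.1.i := fun β =>
    ((mem_act_image_iff hdn τ β.1).mp β.2.1).1
  choose a ha using hroot
  have hj : ∀ β : tangentRoots hdn w τ v, β.1.j ∉ Set.range k.entry := fun β =>
    ((mem_act_image_iff hdn τ β.1).mp β.2.1).2
  let l : tangentRoots hdn w τ v → Idx d n := fun β => cosetIdx hdn (β.1.reflection * τ)
  have hl : ∀ β, Set.range (l β).entry = Set.range (Function.update k.entry (a β) β.1.j) :=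
    fun β => range_cosetIdx_reflection hdn τ β.1 (ha β) (hj β)
  have hlinj : ∀ β γ : tangentRoots hdn w τ v,
      Set.range (l β).entry = Set.range (Function.update k.entry (a γ) γ.1.j) → β = γ := by
    intro β γ h
    obtain ⟨h1, h2⟩ := exchange_unique (hj β) ((hl β).symm.trans h)
    exact Subtype.ext (Root.ext (by rw [← ha β, ← ha γ, h1]) h2)
  have hcurve : ∀ β : tangentRoots hdn w τ v, IsCurveIn
      (richardsonVariety K (cosetIdx hdn w) (cosetIdx hdn v)) (richardsonPoint K hτw hvτ)
      (orbitCurve (β.1.neg.vector K).1 k) := by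
    intro β
    have h : (β.1.neg.vector K).1 = Matrix.single β.1.j (k.entry (a β)) (1 : K) := by
      rw [ha β]
      rfl
    rw [h, orbitCurve_single]
    exact isCurveIn_shear (hj β) (hl β) hτw hvτ β.2.2.1 β.2.2.2
  have hk : (richardsonPoint K hτw hvτ).1.rep k ≠ 0 := (plucker_fixedPoint_rep K k).1
  -- The curves lie in X_w^v itself, so their velocities are tangent vectors to X_w^v and not merely
  -- to the Grassmannian.
  let e : tangentRoots hdn w τ v → richardsonTangentSpace K hdn hτw hvτ :=
    fun β => velocity (hcurve β)
  have he : ∀ β i, (e β).1 (affineCoord hk i)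
      = (incidence K (Function.update k.entry (a β) β.1.j) i).det := by
    intro β i
    have h : (β.1.neg.vector K).1 = Matrix.single β.1.j (k.entry (a β)) (1 : K) := by
      rw [ha β]
      rfl
    refine (velocity_fraction (hcurve β) _ _ _).trans ?_
    rw [h, orbitCurve_single, curveDeriv_shear _ (hj β)]
  have he0 : ∀ β i, Set.range i.entry ≠ Set.range (Function.update k.entry (a β) β.1.j) →
      (e β).1 (affineCoord hk i) = 0 := fun β i h => by
    rw [he, det_incidence_eq_zero h]
  have he1 : ∀ β, (e β).1 (affineCoord hk (l β)) ≠ 0 := fun β => by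
    rw [he]
    exact det_incidence_ne_zero (update_injective _ (hj β)) (hl β)
  have hcoord : ∀ (g : tangentRoots hdn w τ v → K) (i : Idx d n),
      (∑ β, g β • e β).1 (affineCoord hk i) = ∑ β, g β * (e β).1 (affineCoord hk i) := by
    intro g i
    simp [LinearMap.sum_apply]
  -- Evaluation at p_{l β}/p_k isolates the coefficient of `e β`: the exchanged sets `l β` are
  -- pairwise distinct, and `e γ` is nonzero only on its own coordinate.
  have hcoord' : ∀ (g : tangentRoots hdn w τ v → K) (β : tangentRoots hdn w τ v),
      (∑ γ, g γ • e γ).1 (affineCoord hk (l β)) = g β * (e β).1 (affineCoord hk (l β)) := by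
    intro g β
    rw [hcoord, Finset.sum_eq_single β]
    · intro γ _ hγ
      rw [he0 γ _ fun h => hγ (hlinj β γ h).symm, mul_zero]
    · simp
  have hli : LinearIndependent K e := by
    rw [Fintype.linearIndependent_iffₛ]
    intro f g hfg β
    have h := hcoord' f β
    rw [hfg, hcoord'] at h
    exact (mul_right_cancel₀ (he1 β) h).symm
  have hsp : ⊤ ≤ Submodule.span K (Set.range e) := by
    intro D _
    -- The coefficients are forced by evaluating at the coordinates `l β`; what remains is that D
    -- kills all other coordinates.
    have hD : D = ∑ β, (D.1 (affineCoord hk (l β)) / (e β).1 (affineCoord hk (l β))) • e β := by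
      refine tangentSpace_ext hk fun i => ?_
      by_cases hi : ∃ β, i = l β
      · obtain ⟨β, rfl⟩ := hi
        rw [hcoord', div_mul_cancel₀ _ (he1 β)]
      · rw [hcoord, Finset.sum_eq_zero]
        -- If D does not kill p_i/p_k, then v ≤ i ≤ w, i ≠ k, and i has at most one entry outside k.
        -- So i is an exchange of k and comes from a root of the set, a contradiction.
        · by_contra hne
          apply hi
          have h1 : i ≤ cosetIdx hdn w ∧ cosetIdx hdn v ≤ i := by
            by_contra h
            exact hne (tangentSpace_richardson_eq_zero hk D h)
          have h2 : i ≠ k := by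
            rintro rfl
            rw [affineCoord_self, tangentSpace_map_one] at hne
            exact hne rfl
          obtain ⟨b, j, hbj, hr⟩ := exists_exchange h2 fun r s hrs hr => by
            by_contra hs
            exact hne (tangentSpace_affineCoord_eq_zero (richardsonVariety_subset K _ _) rfl hk D
              hrs hr hs)
          let β : Root n := ⟨k.entry b, j, fun h => hbj ⟨b, h⟩⟩
          have h3 : i = cosetIdx hdn (β.reflection * τ) :=
            Idx.ext_range (hr.trans (range_cosetIdx_reflection hdn τ β rfl hbj).symm)
          rw [h3] at h1
          exact ⟨⟨β, (mem_act_image_iff hdn τ β).mpr ⟨⟨b, rfl⟩, hbj⟩, h1⟩, h3⟩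
        · intro β _
          rw [he0 β i fun h => hi ⟨β, Idx.ext_range (h.trans (hl β).symm)⟩, mul_zero]
    rw [hD]
    exact Submodule.sum_mem _ fun β _ =>
      Submodule.smul_mem _ _ (Submodule.subset_span ⟨β, rfl⟩)
  let b := Module.Basis.mk hli hsp
  refine ⟨⟨b, fun β => ?_⟩, ?_⟩
  · rw [Module.Basis.mk_apply]
    -- Both sides are velocities of the same curve, seen in X_w^v and in the Grassmannian.
    exact tangentInclusion_velocity _ (hcurve β) (isCurveIn_orbitCurve _ k)
  · rw [Module.finrank_eq_nat_card_basis b, Nat.card_coe_set_eq]
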